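/- **Setting.** Let $G$ be a continuum (a nonempty compact connected metric space). The order of $x\in G$ is the least cardinal $\kappa$ such that $x$ has arbitrarily small open neighbourhoods whose boundary has at most $\kappa$ points. Assume that $G$ is a *tame graph*: the set of points of order $1$ or of order at least $3$ has countable closure. For an arc $\alpha\subset G$ let $\alpha^\circ$ be $\alpha$ without its two endpoints; $\alpha$ is *free* if $\alpha^\circ$ is open in $G$. A *countable Markov partition* for $f\colon G\to G$ is a countable family $\mathcal P$ of free arcs with pairwise disjoint interiors $i^\circ$, covering $G$ up to a countable set, such that for all $i,j\in\mathcal P$ the map $f$ sends $i$ homeomorphically onto $f(i)$, and $f(i)\cap j^\circ\neq\emptyset$ implies $f(i)\supset j$. Let $f\colon G\to G$ be continuous and topologically mixing (for all nonempty open $U,V$ there is $n$ with $f^m(U)\cap V\ne\emptyset$ for all $m\ge n$), and suppose that $f$ admits a countably infinite Markov partition. Let $\mathcal P$ be a countable Markov partition for $f$, and put $m_{ij}=1$ if $f(i)\supset j$ and $m_{ij}=0$ otherwise, $i,j\in\mathcal P$. Let $\lambda>1$ and let $v=(v_i)_{i\in\mathcal P}$ be a nonzero nonnegative vector with $\sum_{j}m_{ij}v_j\le\lambda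 v_i$ for every $i\in\mathcal P$ and $\sum_i v_i=1$. Put $\lambda_i=\frac1{v_i}\sum_j m_{ij}v_j$ (all $v_i$ are in fact positive), and assume that $\lambda_i<\lambda$ for only finitely many $i$. Let $P=G\setminus\bigcup_{i\in\mathcal P}i^\circ$, and for $n\ge0$ let $\mathcal P_n$ be the set of closures of the connected components of $G\setminus f^{-n}(P)$; its elements are arcs of the form $[i_0\cdots i_n]=i_0\cap f^{-1}(i_1)\cap\dots\cap f^{-n}(i_n)$ with $i_0,\dots,i_n\in\mathcal P$. For $[i_0\cdots i_n]\in\mathcal P_n$ put $\Delta([i_0\cdots i_n])=v_{i_n}/\prod_{\ell=0}^{n-1}\lambda_{i_\ell}$. Let $\mathcal A(G)$ be the set of all points (viewed as one-point sets) and all arcs of $G$, and for distinct $x,y\in G$ let $\mathcal A_{xy}$ be the set of arcs in $G$ with endpoints $x,y$. For $\gamma\in\mathcal A(G)$ define $$A_n(\gamma)=\sum_{\gamma\supset[i_0\cdots i_n]\in\mathcal P_n}\Delta([i_0\cdots i_n]),\qquad A(\gamma)=\sup_{n}A_n(\gamma).$$ **Proposition.** The maps $A_n$, $A$ take values in $[0,\infty)$,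 and: 1. For every $\gamma\in\mathcal A(G)$ and every $n$, $A_n(\gamma)\le A_{n+1}(\gamma)$; hence $A(\gamma)=\lim_{n\to\infty}A_n(\gamma)$. 2. If $\gamma\in\mathcal A(G)$ is not a point, then $A(\gamma)>0$. 3. $A$ is additive: if $\gamma\in\mathcal A(G)$, $t\in\gamma$, and $\gamma_1,\gamma_2\in\mathcal A(G)$ satisfy $\gamma=\gamma_1\cup\gamma_2$ and $\gamma_1\cap\gamma_2=\{t\}$, then $A(\gamma)=A(\gamma_1)+A(\gamma_2)$. 4. If $(\gamma^m)_m$ is a sequence in $\mathcal A(G)$ with $\gamma^m\supset\gamma^{m+1}$ for all $m$ and $\bigcap_m\gamma^m=\{x\}$ for some $x\in G$, then $\lim_{m}A(\gamma^m)=0$. 5. For all distinct $x,y\in G$ there is an arc $\alpha\in\mathcal A_{xy}$ with $A(\alpha)=\inf\{A(\beta):\beta\in\mathcal A_{xy}\}$. -/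

import Mathlib

open Set Filter Topology
open scoped ENNReal

namespace TameGraph

universe u

noncomputable section

variable {G : Type u} [TopologicalSpace G]

/-! ### Arcs -/

/-- `γ` is an arc with endpoints `x` and `y`: the image of `[0,1]` under a continuous injection
(a homeomorphism onto its image when `G` is Hausdorff) sending `0` to `x` and `1` to `y`. -/
def IsArcBetween (x y : G) (γ : Set G) : Prop :=
  ∃ h : unitInterval → G,
    Continuous h ∧ Function.Injective h ∧ range h = γ ∧ h 0 = x ∧ h 1 = y

/-- `γ` is an arc. -/
def IsArc (γ : Set G) : Prop := ∃ x y, IsArcBetween x y γ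

/-- The set of the endpoints of an arc. -/
def arcEnds (γ : Set G) : Set G := {x | ∃ y, IsArcBetween x y γ}

/-- The arc without its endpoints. -/
def arcInterior (γ : Set G) : Set G := γ \ arcEnds γ

/-- A free arc: an arc that is open in the space once its endpoints are removed. -/
def IsFreeArc (γ : Set G) : Prop := IsArc γ ∧ IsOpen (arcInterior γ)

/-- The set of all points (as singletons) and all arcs of `G`. -/
def pointsAndArcs (G : Type u) [TopologicalSpace G] : Set (Set G) :=
  {γ | (∃ x, γ = {x}) ∨ IsArc γ}

/-- The set of all arcs with endpoints `x` and `y`. -/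
def arcsBetween (x y : G) : Set (Set G) := {γ | IsArcBetween x y γ}

/-! ### Tame graphs -/

/-- The (Menger–Urysohn) order of a point: the least cardinal `κ` such that `x` has arbitrarily
small open neighbourhoods whose boundary has at most `κ` points. -/
def pointOrder (x : G) : Cardinal.{u} :=
  sInf {κ | ∀ U : Set G, IsOpen U → x ∈ U →
    ∃ V : Set G, IsOpen V ∧ x ∈ V ∧ V ⊆ U ∧ Cardinal.mk (frontier V) ≤ κ}

/-- The points of order one. -/
def endpoints (G : Type u) [TopologicalSpace G] : Set G := {x | pointOrder x = 1}

/-- The points of order at least three. -/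
def branchpoints (G : Type u) [TopologicalSpace G] : Set G := {x | 3 ≤ pointOrder x}

/-- The defining condition of a tame graph, for a continuum `G`. -/
def IsTameGraph (G : Type u) [TopologicalSpace G] : Prop :=
  (closure (endpoints G ∪ branchpoints G)).Countable

/-- A tame partition: a countable family of free arcs with pairwise disjoint interiors covering
`G` up to a countable set. -/
structure IsTamePartition (P : Set (Set G)) : Prop where
  countable : P.Countable
  freeArc : ∀ i ∈ P, IsFreeArc i
  disjoint : ∀ i ∈ P, ∀ j ∈ P, i ≠ j → Disjoint (arcInterior i) (arcInterior j)
  cover : (⋃₀ P)ᶜ.Countable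

/-! ### Countably Markov and mixing maps -/

/-- A countable Markov partition for `f`. -/
structure IsMarkovPartition (f : G → G) (P : Set (Set G)) : Prop where
  tame : IsTamePartition P
  monotone : ∀ i ∈ P, IsEmbedding fun x : i => f x
  markov : ∀ i ∈ P, ∀ j ∈ P, (f '' i ∩ arcInterior j).Nonempty → j ⊆ f '' i

/-- Topological mixing. -/
def IsTopMixing (f : G → G) : Prop :=
  ∀ U V : Set G, IsOpen U → IsOpen V → U.Nonempty → V.Nonempty →
    ∃ n : ℕ, ∀ m ≥ n, (f^[m] '' U ∩ V).Nonempty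

/-- The class of continuous, countably Markov and mixing maps. -/
structure IsCPM (f : G → G) : Prop where
  continuous : Continuous f
  exists_partition : ∃ P : Set (Set G), IsMarkovPartition f P ∧ P.Infinite
  mixing : IsTopMixing f

open Classical in
/-- The transition matrix of `f` with respect to `P`. -/
def transition (f : G → G) (P : Set (Set G)) (i j : P) : ℝ :=
  if (j : Set G) ⊆ f '' (i : Set G) then 1 else 0

/-- `v` is a `lam`-subeigenvector of the transition matrix: nonzero, nonnegative, and
`M v ≤ lam v` coordinatewise (with convergent row sums). -/
structure IsSubeigenvector (f : G → G) (P : Set (Set G)) (lam : ℝ) (v : P → ℝ) : Prop where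
  nonneg : ∀ i, 0 ≤ v i
  ne_zero : v ≠ 0
  summable : ∀ i, Summable fun j => transition f P i j * v j
  le : ∀ i, ∑' j, transition f P i j * v j ≤ lam * v i

/-- The local expansion rate `(M v)_i / v_i`. -/
def rate (f : G → G) (P : Set (Set G)) (v : P → ℝ) (i : P) : ℝ :=
  (∑' j, transition f P i j * v j) / v i

/-! ### Refined partitions and the arc maps -/

/-- The set of partition points: the complement of the interiors of the partition arcs. -/
def partitionPoints (P : Set (Set G)) : Set G := (⋃ i ∈ P, arcInterior i)ᶜ

/-- The `n`-th refined partition: the closures of the connected components of the complement of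
`f⁻ⁿ(partitionPoints P)`. -/
def refinement (f : G → G) (P : Set (Set G)) (n : ℕ) : Set (Set G) :=
  {α | ∃ x ∈ (f^[n] ⁻¹' partitionPoints P)ᶜ,
    α = closure (connectedComponentIn (f^[n] ⁻¹' partitionPoints P)ᶜ x)}

/-- The set `[i₀ i₁ ⋯ iₙ] = i₀ ∩ f⁻¹ i₁ ∩ ⋯ ∩ f⁻ⁿ iₙ` of a word `i₀ i₁ ⋯ iₙ` over `P`. -/
def cylinder (f : G → G) {P : Set (Set G)} {n : ℕ} (w : Fin (n + 1) → P) : Set G :=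
  ⋂ k : Fin (n + 1), f^[(k : ℕ)] ⁻¹' (w k : Set G)

/-- The weight `v_{iₙ} / (rate i₀ ⋯ rate iₙ₋₁)` of a word `i₀ i₁ ⋯ iₙ`. -/
def weight (f : G → G) (P : Set (Set G)) (v : P → ℝ) {n : ℕ} (w : Fin (n + 1) → P) : ℝ :=
  v (w (Fin.last n)) / ∏ k : Fin n, rate f P v (w k.castSucc)

/-- The arc map `A_n`: the total weight of the arcs `[i₀ ⋯ iₙ]` of the `n`-th refined partition
that are contained in `γ`. -/
def arcMapN (f : G → G) (P : Set (Set G)) (v : P → ℝ) (n : ℕ) (γ : Set G) : ℝ≥0∞ :=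
  ∑' w : {w : Fin (n + 1) → P // cylinder f w ∈ refinement f P n ∧ cylinder f w ⊆ γ},
    ENNReal.ofReal (weight f P v w.1)

/-- The arc map `A`, the supremum of the arc maps `A_n`. -/
def arcMap (f : G → G) (P : Set (Set G)) (v : P → ℝ) (γ : Set G) : ℝ≥0∞ :=
  ⨆ n : ℕ, arcMapN f P v n γ

end

end TameGraph

namespace TameGraph

universe u

/-! ### Markov measures -/

/-! The proof is probabilistic. The numbers p_ij = m_ij v_j / (λ_i v_i) form a stochastic matrix and
`v` is a probability vector. The corresponding Markov chain gives an admissible word i₀⋯iₙ the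
probability v_{i₀} p_{i₀i₁}⋯p_{iₙ₋₁iₙ}, which telescopes to Δ([i₀⋯iₙ]). Hence A_n(γ) is the
probability that the n-th cylinder of a random path lies in γ and, cylinders being nested, A(γ) is
the probability that some cylinder does (`IsPathMeasure.wordSum_eq`, `IsPathMeasure.wordSup_eq`).
Finiteness and monotonicity are then immediate.

Positivity holds because an arc has interior points and, by mixing, every nonempty open set contains
a cylinder. Additivity, continuity and the minimum rest on one fact: for a fixed point x, almost no
path has x in all its cylinders (`IsPathMeasure.measure_mem_cyl_eq_zero`). Such paths are countable
in number, since in each partition arc at most one follows x from either side, and each single path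
is null because its weights tend to 0 (`IsSubeigen.tendsto_pathWeight`). Indeed, a path returning to
some arc forever also returns forever to a branching arc, where the transition probabilities stay
below a constant c < 1; a path leaving every arc for good eventually has all its rates equal to λ >
1, by finite deficiency.

For the minimum, pass to a minimizing sequence of arcs along which every cylinder is eventually
contained or eventually not contained. The upper limit is a continuum, and it contains an arc α from
x to y. Almost every path counted by α has a cylinder in α that misses x and y; an arc of the
sequence that meets the interior of this cylinder must contain all of it, so eventually all of them
do, and a Fatou argument bounds A(α) by the infimum.

That subcontinua are arcwise connected (`IsArcFamily.exists_isArcBetween`) is proved by taking a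
continuum M irreducible between x and y. Each free arc met by M cuts it into an x-side and a y-side
and so yields a function from 0 at x to 1 at y. A weighted sum of these functions is injective off a
countable set, hence injective, and it parametrizes M. -/

open MeasureTheory ProbabilityTheory in
/-- A Markov chain on a countable set, with its cylinder probabilities. -/
theorem exists_markovMeasure {ι : Type u} [Countable ι] (v : ι → ℝ≥0∞) (hv : ∑' i, v i = 1)
    (p : ι → ι → ℝ≥0∞) (hp : ∀ i, ∑' j, p i j = 1) :
    ∃ (_ : MeasurableSpace (ℕ → ι)) (μ : Measure (ℕ → ι)), IsProbabilityMeasure μ ∧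
      (∀ n i, MeasurableSet {ω : ℕ → ι | ω n = i}) ∧
      ∀ n (w : ℕ → ι), μ {ω | ∀ k ≤ n, ω k = w k} =
        v (w 0) * ∏ k ∈ Finset.range n, p (w k) (w (k + 1)) := by
  let _ : MeasurableSpace ι := ⊤
  have : DiscreteMeasurableSpace ι := ⟨fun _ => trivial⟩
  let q₀ : PMF ι := ⟨v, hv ▸ ENNReal.summable.hasSum⟩
  let μ₀ : Measure ι := q₀.toMeasure
  have : IsProbabilityMeasure μ₀ := inferInstanceAs (IsProbabilityMeasure q₀.toMeasure)
  let q : ι → PMF ι := fun i => ⟨p i, hp i ▸ ENNReal.summable.hasSum⟩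
  -- Markov property: the kernel reads only the last coordinate of the history.
  let κ : (n : ℕ) → Kernel (Π _ : Finset.Iic n, ι) ι := fun n =>
    { toFun := fun u => (q (u ⟨n, by simp⟩)).toMeasure
      measurable' :=
        (Measurable.of_discrete (f := fun i : ι => (q i).toMeasure)).comp
          (measurable_pi_apply (⟨n, by simp⟩ : Finset.Iic n)) }
  have : ∀ n, IsMarkovKernel (κ n) := fun n => ⟨fun u => by
    change IsProbabilityMeasure (q _).toMeasure; infer_instance⟩
  refine ⟨inferInstance, Kernel.trajMeasure (X := fun _ => ι) μ₀ κ, inferInstance,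
    fun n i => measurable_pi_apply (X := fun _ : ℕ => ι) n (measurableSet_singleton i), fun n w => ?_⟩
  induction n with
  | zero =>
    have h0 : (Kernel.trajMeasure (X := fun _ => ι) μ₀ κ).map (Preorder.frestrictLe 0) =
        μ₀.map (MeasurableEquiv.piUnique (fun _ : Finset.Iic 0 => ι)).symm := by
      rw [Kernel.trajMeasure, Measure.map_comp _ _ (by fun_prop), Kernel.traj_map_frestrictLe,
        Kernel.partialTraj_self, Measure.id_comp]
    have h1 : {ω : ℕ → ι | ∀ k ≤ 0, ω k = w k} =
        Preorder.frestrictLe (π := fun _ => ι) 0 ⁻¹'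
          {u | u ⟨0, by simp⟩ = w 0} := by
      ext ω; simp
    have hm : MeasurableSet {u : Π _ : Finset.Iic 0, ι | u ⟨0, by simp⟩ = w 0} :=
      measurable_pi_apply (X := fun _ : Finset.Iic 0 => ι) _ (measurableSet_singleton (w 0))
    rw [h1, ← Measure.map_apply (by fun_prop) hm, h0, Measure.map_apply (by fun_prop) hm]
    have h2 : (MeasurableEquiv.piUnique (fun _ : Finset.Iic 0 => ι)).symm ⁻¹'
        {u | u ⟨0, by simp⟩ = w 0} = {w 0} := by
      ext i; simp
    rw [h2, PMF.toMeasure_apply_singleton _ _ (measurableSet_singleton _)]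
    simp; rfl
  | succ n ih =>
    have hmap := Kernel.map_frestrictLe_trajMeasure_compProd_eq_map_trajMeasure
      (X := fun _ => ι) (μ₀ := μ₀) (κ := κ) (a := n)
    let S : Set (Π _ : Finset.Iic n, ι) := {Preorder.frestrictLe (π := fun _ => ι) n w}
    have hS : MeasurableSet S := measurableSet_singleton _
    have hT : MeasurableSet (S ×ˢ {w (n + 1)}) := hS.prod (measurableSet_singleton _)
    have h1 : {ω : ℕ → ι | ∀ k ≤ n + 1, ω k = w k} =
        (fun x : ℕ → ι => (Preorder.frestrictLe (π := fun _ => ι) n x, x (n + 1))) ⁻¹'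
          (S ×ˢ {w (n + 1)}) := by
      ext ω
      simp only [mem_ofPred_eq, mem_preimage, mem_prod, S, mem_singleton_iff, funext_iff,
        Subtype.forall, Finset.mem_Iic, Preorder.frestrictLe_apply]
      exact ⟨fun h => ⟨fun k hk => h k (by omega), h _ le_rfl⟩, fun h k hk => by
        rcases Nat.lt_or_ge n k with h' | h'
        · obtain rfl : k = n + 1 := by omega
          exact h.2
        · exact h.1 k h'⟩
    have h2 : {ω : ℕ → ι | ∀ k ≤ n, ω k = w k} =
        Preorder.frestrictLe (π := fun _ => ι) n ⁻¹' S := by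
      ext ω; simp [S, funext_iff]
    rw [h1, ← Measure.map_apply (by fun_prop) hT, ← hmap, Measure.compProd_apply_prod hS
      (measurableSet_singleton _), Measure.restrict_singleton, lintegral_smul_measure,
      lintegral_dirac, Measure.map_apply (by fun_prop) hS, ← h2, ih, Finset.prod_range_succ,
      smul_eq_mul, mul_assoc]
    congr 2
    exact PMF.toMeasure_apply_singleton _ _ (measurableSet_singleton _)

/-! ### Lifting and monotonicity -/

/-- A continuous injection from a compact space to a Hausdorff space is an embedding. Lifting
through an arc turns questions about subarcs into questions about maps into `[0,1]`, where
continuous injections are strictly monotone. -/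
theorem exists_continuous_lift {X Y Z : Type*} [TopologicalSpace X] [TopologicalSpace Y]
    [TopologicalSpace Z] [CompactSpace X] [T2Space Y] {h : X → Y} (hc : Continuous h)
    (hi : Function.Injective h) {k : Z → Y} (kc : Continuous k) (hk : range k ⊆ range h) :
    ∃ ψ : Z → X, Continuous ψ ∧ ∀ z, h (ψ z) = k z := by
  choose ψ hψ using fun z => hk (mem_range_self z)
  refine ⟨ψ, (hc.isClosedEmbedding hi).isEmbedding.continuous_iff.2 ?_, hψ⟩
  rwa [show h ∘ ψ = k from funext hψ]

section ArcParam

variable {G : Type u} [TopologicalSpace G] {h g : unitInterval → G}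

theorem isArcBetween_symm {x y : G} {γ : Set G} (hγ : IsArcBetween x y γ) :
    IsArcBetween y x γ := by
  obtain ⟨h, hc, hi, hr, h0, h1⟩ := hγ
  refine ⟨h ∘ unitInterval.symm, hc.comp unitInterval.continuous_symm,
    hi.comp unitInterval.symm_bijective.injective, ?_, by simpa, by simpa⟩
  rw [unitInterval.symm_bijective.surjective.range_comp, hr]

theorem image_Ioo_subset_of_range_subset [T2Space G] (hc : Continuous h) (hi : Function.Injective h)
    (gc : Continuous g) (gi : Function.Injective g) (hgh : range g ⊆ range h) :
    g '' Ioo 0 1 ⊆ h '' Ioo 0 1 := by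
  obtain ⟨ψ, ψc, hψ⟩ := exists_continuous_lift hc hi gc hgh
  have ψi : Function.Injective ψ := fun a b hab => gi (by rw [← hψ, ← hψ, hab])
  rintro _ ⟨s, ⟨hs0, hs1⟩, rfl⟩
  refine ⟨ψ s, ?_, hψ s⟩
  rcases ψc.strictMono_of_inj_boundedOrder' ψi with hm | hm
  · exact ⟨unitInterval.nonneg'.trans_lt (hm hs0), (hm hs1).trans_le unitInterval.le_one'⟩
  · exact ⟨unitInterval.nonneg'.trans_lt (hm hs1), (hm hs0).trans_le unitInterval.le_one'⟩

omit [TopologicalSpace G] in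
theorem image_Ioo_eq_range_diff (hi : Function.Injective h) :
    h '' Ioo 0 1 = range h \ {h 0, h 1} := by
  rw [← image_univ, ← image_pair, ← image_sdiff hi]
  congr 1
  ext s
  simp only [mem_Ioo, Set.mem_sdiff, mem_univ, true_and, mem_insert_iff, mem_singleton_iff, not_or]
  exact ⟨fun hs => ⟨hs.1.ne', hs.2.ne⟩, fun hs => ⟨unitInterval.pos_iff_ne_zero.2 hs.1,
    unitInterval.lt_one_iff_ne_one.2 hs.2⟩⟩

theorem arcEnds_range [T2Space G] (hc : Continuous h) (hi : Function.Injective h) :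
    arcEnds (range h) = {h 0, h 1} := by
  apply Subset.antisymm
  · rintro _ ⟨_, g, gc, gi, hr, rfl, -⟩
    by_contra hn
    have h1 : g 0 ∈ h '' Ioo 0 1 := by
      rw [image_Ioo_eq_range_diff hi]; exact ⟨hr ▸ mem_range_self 0, hn⟩
    have h2 := image_Ioo_subset_of_range_subset gc gi hc hi hr.symm.subset h1
    obtain ⟨s, hs, hs'⟩ := h2
    exact hs.1.ne' (gi hs')
  · have hA : IsArcBetween (h 0) (h 1) (range h) := ⟨h, hc, hi, rfl, rfl, rfl⟩
    rintro _ (rfl | rfl)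
    exacts [⟨_, hA⟩, ⟨_, isArcBetween_symm hA⟩]

theorem arcInterior_range [T2Space G] (hc : Continuous h) (hi : Function.Injective h) :
    arcInterior (range h) = h '' Ioo 0 1 := by
  rw [arcInterior, arcEnds_range hc hi, image_Ioo_eq_range_diff hi]

/-- The image of `O` is the open arc minus the compact image of the complement of `O`. -/
theorem isOpen_image_of_subset_Ioo [T2Space G] (hc : Continuous h) (hi : Function.Injective h)
    (ho : IsOpen (h '' Ioo 0 1)) {O : Set unitInterval} (hO : IsOpen O) (hs : O ⊆ Ioo 0 1) :
    IsOpen (h '' O) := by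
  have : h '' O = h '' Ioo 0 1 ∩ (h '' Oᶜ)ᶜ := by
    rw [← sdiff_eq, ← image_sdiff hi, sdiff_compl, inter_eq_right.2 hs]
  rw [this]
  exact ho.inter (hO.isClosed_compl.isCompact.image hc).isClosed.isOpen_compl

/-- An interior point of an arc lying in the interior of a free arc is an interior point of the
arc as a subset of the space. -/
theorem mem_interior_range [T2Space G] (hc : Continuous h) (hi : Function.Injective h)
    (ho : IsOpen (h '' Ioo 0 1)) (gc : Continuous g) (gi : Function.Injective g)
    {t : unitInterval} (ht : t ∈ Ioo 0 1) (hgt : g t ∈ h '' Ioo 0 1) :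
    g t ∈ interior (range g) := by
  obtain ⟨l, u, ⟨hl, hu⟩, hlu⟩ := (mem_nhds_iff_exists_Ioo_subset' ⟨0, ht.1⟩ ⟨1, ht.2⟩).1
    ((ho.preimage gc).mem_nhds hgt)
  obtain ⟨a, hla, hat⟩ := exists_between hl
  obtain ⟨b, htb, hbu⟩ := exists_between hu
  have hab : a ≤ b := (hat.trans htb).le
  have : Fact (a ≤ b) := ⟨hab⟩
  let k : Icc a b → G := fun s => g s
  have kc : Continuous k := gc.comp continuous_subtype_val
  have ki : Function.Injective k := gi.comp Subtype.val_injective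
  obtain ⟨ψ, ψc, hψ⟩ := exists_continuous_lift hc hi kc (by
    rintro _ ⟨s, rfl⟩
    exact image_subset_range _ _ (hlu ⟨hla.trans_le s.2.1, s.2.2.trans_lt hbu⟩))
  have ψi : Function.Injective ψ := fun a b hab => ki (by rw [← hψ, ← hψ, hab])
  have hsub : ∀ s, ψ s ∈ Ioo 0 1 := fun s => by
    obtain ⟨r, hr, hr'⟩ := hlu ⟨hla.trans_le s.2.1, s.2.2.trans_lt hbu⟩
    rwa [show ψ s = r from hi (by rw [hψ, hr'])]
  let A : Icc a b := ⟨a, left_mem_Icc.2 hab⟩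
  let B : Icc a b := ⟨b, right_mem_Icc.2 hab⟩
  let T : Icc a b := ⟨t, hat.le, htb.le⟩
  -- By the intermediate value theorem the lift `ψ` covers the interval between `ψ p` and `ψ q`,
  -- whose image under `h` is open. Whether `ψ` increases or decreases only decides which of `A`,
  -- `B` plays which role.
  have key : ∀ p q, ψ p < ψ T → ψ T < ψ q → g t ∈ interior (range g) := by
    intro p q hp hq
    refine mem_interior.2 ⟨h '' Ioo (ψ p) (ψ q), ?_, isOpen_image_of_subset_Ioo hc hi ho isOpen_Ioo
      fun s hs => ⟨(hsub p).1.trans hs.1, hs.2.trans (hsub q).2⟩, ψ T, ⟨hp, hq⟩, hψ T⟩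
    rintro _ ⟨s, hs, rfl⟩
    obtain ⟨r, rfl⟩ := mem_range_of_exists_le_of_exists_ge ψc ⟨p, hs.1.le⟩ ⟨q, hs.2.le⟩
    exact ⟨r, (hψ r).symm⟩
  rcases ψc.strictMono_of_inj_boundedOrder' ψi with hm | hm
  · exact key A B (hm hat) (hm htb)
  · exact key B A (hm htb) (hm hat)

omit [TopologicalSpace G] in
theorem image_Ioo_nonempty : (g '' Ioo 0 1).Nonempty :=
  (nonempty_Ioo.2 zero_lt_one).image g

theorem isPreconnected_image_Ioo (hc : Continuous h) : IsPreconnected (h '' Ioo 0 1) :=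
  isPreconnected_Ioo.image _ hc.continuousOn

/-- An arc that meets the interior of a free arc and has no endpoint there contains it. -/
theorem image_Ioo_subset_of_inter_nonempty [T2Space G] (hc : Continuous h) (hi : Function.Injective h)
    (ho : IsOpen (h '' Ioo 0 1)) (gc : Continuous g) (gi : Function.Injective g)
    (h0 : g 0 ∉ h '' Ioo 0 1) (h1 : g 1 ∉ h '' Ioo 0 1)
    (hne : (range g ∩ h '' Ioo 0 1).Nonempty) : h '' Ioo 0 1 ⊆ range g := by
  have key : range g ∩ h '' Ioo 0 1 ⊆ interior (range g) := by
    rintro _ ⟨⟨t, rfl⟩, ht⟩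
    refine mem_interior_range hc hi ho gc gi ⟨?_, ?_⟩ ht
    · exact unitInterval.pos_iff_ne_zero.2 (by rintro rfl; exact h0 ht)
    · exact unitInterval.lt_one_iff_ne_one.2 (by rintro rfl; exact h1 ht)
  -- By `key` the trace of `range g` on the open arc is open; it is also relatively closed, and the
  -- open arc is connected.
  by_contra hn
  obtain ⟨q, hq, hqg⟩ := not_subset.1 hn
  obtain ⟨p, hpg, hp⟩ := hne
  obtain ⟨z, -, hz1, hz2⟩ := isPreconnected_image_Ioo hc (interior (range g)) (range g)ᶜ
    isOpen_interior (isCompact_range gc).isClosed.isOpen_compl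
    (fun z hz => (em (z ∈ range g)).imp (fun h => key ⟨h, hz⟩) id) ⟨p, hp, key ⟨hpg, hp⟩⟩
    ⟨q, hq, hqg⟩
  exact hz2 (interior_subset hz1)

theorem closure_image_Ioo [T2Space G] (hc : Continuous h) : closure (h '' Ioo 0 1) = range h := by
  rw [← image_closure_of_isCompact (isClosed_closure.isCompact) hc.continuousOn,
    closure_Ioo (by simp), ← image_univ]
  congr 1
  ext s; simp [unitInterval.le_one']

theorem IsFreeArc.exists_param [T2Space G] {i : Set G} (hi : IsFreeArc i) :
    ∃ h : unitInterval → G, Continuous h ∧ Function.Injective h ∧ range h = i ∧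
      arcInterior i = h '' Ioo 0 1 ∧ IsOpen (h '' Ioo 0 1) := by
  obtain ⟨⟨_, _, h, hc, hinj, rfl, -, -⟩, ho⟩ := hi
  have := arcInterior_range hc hinj
  exact ⟨h, hc, hinj, rfl, this, this ▸ ho⟩

end ArcParam

/-! ### Countable sets and connectedness -/

section Countable

variable {G : Type u} [MetricSpace G]

/-- The distance to `p` takes on `K` every small positive value, and the points where it does so lie
in `U`. -/
theorem not_countable_inter_of_isPreconnected {K U : Set G} (hK : IsPreconnected K) {p q : G}
    (hp : p ∈ K) (hq : q ∈ K) (hpq : p ≠ q) (hU : IsOpen U) (hpU : p ∈ U) :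
    ¬ (K ∩ U).Countable := by
  intro hcount
  obtain ⟨r, hr, hrU⟩ := Metric.isOpen_iff.1 hU p hpU
  have hm : 0 < min r (dist q p) := lt_min hr (dist_pos.2 hpq.symm)
  have hsub : Ioo 0 (min r (dist q p)) ⊆ (fun z => dist z p) '' (K ∩ U) := by
    intro s hs
    obtain ⟨z, hz, hzs⟩ := hK.intermediate_value hp hq
      (continuous_id.dist continuous_const).continuousOn (f := fun z => dist z p)
      ⟨by simpa using hs.1.le, (hs.2.trans_le (min_le_right _ _)).le⟩
    refine ⟨z, ⟨hz, hrU ?_⟩, hzs⟩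
    rw [Metric.mem_ball]
    exact hzs.trans_lt (hs.2.trans_le (min_le_left _ _))
  have h2 := (hcount.image (fun z => dist z p)).mono hsub
  rw [← Cardinal.le_aleph0_iff_set_countable, Cardinal.mk_Ioo_real hm] at h2
  exact Cardinal.aleph0_lt_continuum.not_ge h2

theorem not_countable_of_isPreconnected {K : Set G} (hK : IsPreconnected K) {p q : G}
    (hp : p ∈ K) (hq : q ∈ K) (hpq : p ≠ q) : ¬ K.Countable := by
  have := not_countable_inter_of_isPreconnected hK hp hq hpq isOpen_univ (mem_univ p)
  rwa [inter_univ] at this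

theorem not_countable_Ioo_unitInterval {a b : unitInterval} (hab : a < b) :
    ¬ (Ioo a b).Countable := by
  obtain ⟨c, hac, hcb⟩ := exists_between hab
  obtain ⟨d, had, hdc⟩ := exists_between hac
  exact not_countable_of_isPreconnected isPreconnected_Ioo ⟨hac, hcb⟩ ⟨had, hdc.trans hcb⟩ hdc.ne'

theorem dense_compl_of_countable [ConnectedSpace G] [Nontrivial G] {Q : Set G}
    (hQ : Q.Countable) : Dense Qᶜ := by
  intro p
  rw [mem_closure_iff]
  intro U hU hpU
  by_contra hn
  obtain ⟨q, hq⟩ := exists_ne p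
  refine not_countable_inter_of_isPreconnected isPreconnected_univ (mem_univ p) (mem_univ q)
    hq.symm hU hpU (hQ.mono fun z hz => ?_)
  by_contra hzQ
  exact hn ⟨z, hz.2, hzQ⟩

end Countable

/-! ### Arcs in subcontinua -/

theorem isCompact_iInter_of_nonempty {X : Type*} {ι : Type*} [TopologicalSpace X] [T2Space X]
    [Nonempty ι] {K : ι → Set X} (hc : ∀ i, IsCompact (K i)) : IsCompact (⋂ i, K i) :=
  (hc (Classical.arbitrary ι)).of_isClosed_subset (isClosed_iInter fun i => (hc i).isClosed)
    (iInter_subset _ _)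

/-- A splitting of the intersection extends to disjoint open sets, and by compactness some `K i`
already lies in their union and would be split too. -/
theorem isPreconnected_iInter_of_directed {X : Type*} {ι : Type*} [TopologicalSpace X] [T2Space X]
    [Nonempty ι] {K : ι → Set X} (hd : Directed (· ⊇ ·) K) (hc : ∀ i, IsCompact (K i))
    (hK : ∀ i, IsPreconnected (K i)) : IsPreconnected (⋂ i, K i) := by
  rw [isPreconnected_closed_iff]
  intro t t' ht ht' hsub hne hne'
  by_contra hn
  have hcl : IsCompact (⋂ i, K i) := isCompact_iInter_of_nonempty hc
  obtain ⟨U, V, hU, hV, hAU, hBV, hUV⟩ := SeparatedNhds.of_isCompact_isCompact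
    (hcl.inter_right ht) (hcl.inter_right ht') (by
      rw [disjoint_left]
      exact fun z hz hz' => hn ⟨z, hz.1, hz.2, hz'.2⟩)
  obtain ⟨i, hi⟩ := exists_subset_nhds_of_isCompact hd hc (U := U ∪ V) (fun z hz =>
    (hU.union hV).mem_nhds ((hsub hz).imp (fun h => hAU ⟨hz, h⟩) fun h => hBV ⟨hz, h⟩))
  obtain ⟨p, hp, hpt⟩ := hne
  obtain ⟨q, hq, hqt⟩ := hne'
  obtain ⟨z, -, hz, hz'⟩ := hK i U V hU hV hi ⟨p, mem_iInter.1 hp i, hAU ⟨hp, hpt⟩⟩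
    ⟨q, mem_iInter.1 hq i, hBV ⟨hq, hqt⟩⟩
  exact disjoint_left.1 hUV hz hz'

/-- `M` is a continuum irreducible between `x` and `y`. -/
structure IsIrreducibleBetween {X : Type*} [TopologicalSpace X] (x y : X) (M : Set X) : Prop where
  isCompact : IsCompact M
  isPreconnected : IsPreconnected M
  left_mem : x ∈ M
  right_mem : y ∈ M
  minimal : ∀ K ⊆ M, IsCompact K → IsPreconnected K → x ∈ K → y ∈ K → M ⊆ K

/-- Zorn's lemma: the intersection of a chain of continua containing both points is again such a
continuum. -/
theorem exists_isIrreducibleBetween {X : Type*} [TopologicalSpace X] [T2Space X] {x y : X}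
    {K : Set X} (hc : IsCompact K) (hK : IsPreconnected K) (hx : x ∈ K) (hy : y ∈ K) :
    ∃ M ⊆ K, IsIrreducibleBetween x y M := by
  let S : Set (Set X) := {L | L ⊆ K ∧ IsCompact L ∧ IsPreconnected L ∧ x ∈ L ∧ y ∈ L}
  obtain ⟨M, hM⟩ := zorn_superset S (by
    intro c hcS hchain
    rcases c.eq_empty_or_nonempty with rfl | hne
    · exact ⟨K, ⟨Subset.rfl, hc, hK, hx, hy⟩, fun s hs => hs.elim⟩
    have := hne.to_subtype
    refine ⟨⋂ s : c, (s : Set X), ⟨?_, isCompact_iInter_of_nonempty fun s => (hcS s.2).2.1,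
      isPreconnected_iInter_of_directed ?_ (fun s => (hcS s.2).2.1) fun s => (hcS s.2).2.2.1,
      mem_iInter.2 fun s => (hcS s.2).2.2.2.1, mem_iInter.2 fun s => (hcS s.2).2.2.2.2⟩,
      fun s hs => iInter_subset (fun s : c => (s : Set X)) ⟨s, hs⟩⟩
    · obtain ⟨s, hs⟩ := hne
      exact (iInter_subset (fun s : c => (s : Set X)) ⟨s, hs⟩).trans (hcS hs).1
    · intro a b
      rcases hchain.total a.2 b.2 with h | h
      exacts [⟨a, Subset.rfl, h⟩, ⟨b, h, Subset.rfl⟩])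
  exact ⟨M, hM.1.1, hM.1.2.1, hM.1.2.2.1, hM.1.2.2.2.1, hM.1.2.2.2.2,
    fun L hL h1 h2 h3 h4 => hM.2 ⟨hL.trans hM.1.1, h1, h2, h3, h4⟩ hL⟩

theorem subset_of_isPreconnected_of_isClosed {X : Type*} [TopologicalSpace X]
    {M A B : Set X} (hM : IsPreconnected M) (hA : IsClosed A) (hB : IsClosed B)
    (hcov : M ⊆ A ∪ B) (hdis : ∀ z ∈ M, z ∈ A → z ∉ B) {p : X} (hp : p ∈ M) (hpA : p ∈ A) :
    M ⊆ A := by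
  intro q hq
  by_contra hqA
  obtain ⟨z, hz, hzA, hzB⟩ := isPreconnected_closed_iff.1 hM A B hA hB hcov ⟨p, hp, hpA⟩
    ⟨q, hq, (hcov hq).resolve_left hqA⟩
  exact hdis z hz hzA hzB

/-! ### Free arcs separate irreducible continua -/

section

variable {G : Type u} [MetricSpace G] {x y : G} {M : Set G} {h : unitInterval → G}

/-- A free arc in an irreducible continuum separates it. -/
theorem IsIrreducibleBetween.exists_separation (hM : IsIrreducibleBetween x y M)
    (hc : Continuous h) (hi : Function.Injective h) (ho : IsOpen (h '' Ioo 0 1))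
    (hx : x ∉ h '' Ioo 0 1) (hy : y ∉ h '' Ioo 0 1) (hne : (M ∩ h '' Ioo 0 1).Nonempty) :
    ∃ k : unitInterval → G, Continuous k ∧ Function.Injective k ∧ range k = range h ∧
      range k ⊆ M ∧ ∃ A B : Set G, IsClosed A ∧ IsClosed B ∧ Disjoint A B ∧
      M \ h '' Ioo 0 1 = A ∪ B ∧ x ∈ A ∧ y ∈ B ∧ k 0 ∈ A ∧ k 1 ∈ B := by
  have hcl : IsClosed (M \ h '' Ioo 0 1) := hM.isCompact.isClosed.sdiff ho
  have hcomp : IsCompact (M \ h '' Ioo 0 1) := hM.isCompact.diff ho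
  let L := M \ h '' Ioo 0 1
  have : CompactSpace L := isCompact_iff_compactSpace.1 hcomp
  let x' : L := ⟨x, hM.left_mem, hx⟩
  let y' : L := ⟨y, hM.right_mem, hy⟩
  -- Otherwise this component would be a continuum joining `x` to `y` that omits a point of `M`,
  -- against irreducibility. In a compact Hausdorff space components are intersections of clopen
  -- sets, so a clopen `Z` then splits `x` from `y`.
  have hy' : y' ∉ connectedComponent x' := by
    intro hmem
    obtain ⟨p, hpM, hp⟩ := hne
    have hsub : ((↑) : L → G) '' connectedComponent x' ⊆ L := by
      rintro _ ⟨z, -, rfl⟩; exact z.2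
    have := hM.minimal _ (hsub.trans sdiff_subset)
      (isClosed_connectedComponent.isCompact.image continuous_subtype_val)
      (isPreconnected_connectedComponent.image _ continuous_subtype_val.continuousOn)
      ⟨x', mem_connectedComponent, rfl⟩ ⟨y', hmem, rfl⟩ hpM
    exact (hsub this).2 hp
  rw [connectedComponent_eq_iInter_isClopen, mem_iInter] at hy'
  push Not at hy'
  obtain ⟨⟨Z, hZ, hxZ⟩, hyZ⟩ := hy'
  let A : Set G := (↑) '' Z
  let B : Set G := ((↑) : L → G) '' Zᶜ
  have hA : IsClosed A := (hZ.1.isCompact.image continuous_subtype_val).isClosed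
  have hB : IsClosed B := (hZ.compl.1.isCompact.image continuous_subtype_val).isClosed
  have hAB : Disjoint A B := (disjoint_image_iff Subtype.val_injective).2 disjoint_compl_right
  have hun : L = A ∪ B := by
    rw [← image_union, union_compl_self, image_univ, Subtype.range_coe]
  have hxA : x ∈ A := ⟨x', hxZ, rfl⟩
  have hyB : y ∈ B := ⟨y', hyZ, rfl⟩
  have hAM : A ⊆ M := (subset_union_left.trans hun.symm.subset).trans sdiff_subset
  have hBM : B ⊆ M := (subset_union_right.trans hun.symm.subset).trans sdiff_subset
  have hcov : M ⊆ A ∪ B ∪ range h := fun z hz => by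
    by_cases hzI : z ∈ h '' Ioo 0 1
    · exact Or.inr (image_subset_range _ _ hzI)
    · exact Or.inl (hun ▸ (⟨hz, hzI⟩ : z ∈ L))
  have hend : ∀ z ∈ L, z ∈ range h → z = h 0 ∨ z = h 1 := fun z hz hzr => by
    by_contra hn
    exact hz.2 (image_Ioo_eq_range_diff hi ▸ ⟨hzr, hn⟩)
  have hr : IsClosed (range h) := (isCompact_range hc).isClosed
  -- If neither end of the arc were in `A`, then `A` and `B ∪ range h` would disconnect `M`.
  have hAe : h 0 ∈ A ∨ h 1 ∈ A := by
    by_contra hn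
    refine disjoint_left.1 hAB (subset_of_isPreconnected_of_isClosed hM.isPreconnected hA
      (hB.union hr) (by rwa [← union_assoc]) (fun z _ hzA hz => ?_) hM.left_mem hxA
      hM.right_mem) hyB
    rcases hz with hz | hz
    · exact disjoint_left.1 hAB hzA hz
    · rcases hend z (hun ▸ Or.inl hzA) hz with rfl | rfl
      exacts [hn (Or.inl hzA), hn (Or.inr hzA)]
  have hBe : h 0 ∈ B ∨ h 1 ∈ B := by
    by_contra hn
    refine disjoint_left.1 hAB hxA (subset_of_isPreconnected_of_isClosed
      hM.isPreconnected hB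
      (hA.union hr) (by rwa [← union_assoc, union_comm B]) (fun z _ hzB hz => ?_) hM.right_mem hyB
      hM.left_mem)
    rcases hz with hz | hz
    · exact disjoint_left.1 hAB hz hzB
    · rcases hend z (hun ▸ Or.inr hzB) hz with rfl | rfl
      exacts [hn (Or.inl hzB), hn (Or.inr hzB)]
  have hends : h 0 ∈ A ∧ h 1 ∈ B ∨ h 1 ∈ A ∧ h 0 ∈ B := by
    rcases hAe with h0 | h0 <;> rcases hBe with h1 | h1
    · exact (disjoint_left.1 hAB h0 h1).elim
    · exact Or.inl ⟨h0, h1⟩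
    · exact Or.inr ⟨h0, h1⟩
    · exact (disjoint_left.1 hAB h0 h1).elim
  obtain ⟨k, kc, ki, kr, k0, k1⟩ : ∃ k : unitInterval → G, Continuous k ∧ Function.Injective k ∧
      range k = range h ∧ k 0 ∈ A ∧ k 1 ∈ B := by
    rcases hends with ⟨h0, h1⟩ | ⟨h0, h1⟩
    · exact ⟨h, hc, hi, rfl, h0, h1⟩
    · exact ⟨h ∘ unitInterval.symm, hc.comp unitInterval.continuous_symm,
        hi.comp unitInterval.symm_bijective.injective,
        unitInterval.symm_bijective.surjective.range_comp h, by simpa, by simpa⟩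
  refine ⟨k, kc, ki, kr, ?_, A, B, hA, hB, hAB, hun, hxA, hyB, k0, k1⟩
  rintro _ ⟨s, rfl⟩
  by_contra ks
  have hend' : ∀ r, k r ∈ L → r = 0 ∨ r = 1 := fun r hr => by
    have he := hend _ hr (kr ▸ mem_range_self r)
    have h0 : k 0 ∈ range h := kr ▸ mem_range_self _
    have h1 : k 1 ∈ range h := kr ▸ mem_range_self _
    have e0 := hend _ (hun ▸ Or.inl k0) h0
    have e1 := hend _ (hun ▸ Or.inr k1) h1
    have hne : k 0 ≠ k 1 := fun e => zero_ne_one (ki e)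
    have : k r = k 0 ∨ k r = k 1 := by
      grind
    exact this.imp (fun e => ki e) fun e => ki e
  have hs0 : 0 < s := unitInterval.pos_iff_ne_zero.2 (by rintro rfl; exact ks (hAM k0))
  have hs1 : s < 1 := unitInterval.lt_one_iff_ne_one.2 (by rintro rfl; exact ks (hBM k1))
  refine disjoint_left.1 hAB ?_ hyB
  -- If `k s` were missing from `M`, cutting the arc at `s` would split `M` into `A` with the first
  -- half and `B` with the second half.
  have hyA : y ∈ A ∪ k '' Iic s := subset_of_isPreconnected_of_isClosed
    hM.isPreconnected (B := B ∪ k '' Ici s)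
    (hA.union (isClosed_Iic.isCompact.image kc).isClosed)
    (hB.union (isClosed_Ici.isCompact.image kc).isClosed) (fun z hz => ?_) (fun z hz h1 h2 => ?_)
    hM.left_mem (Or.inl hxA) hM.right_mem
  · rcases hyA with h | ⟨r, hr, hry⟩
    · exact h
    · rcases hend' r (hry ▸ hun ▸ Or.inr hyB) with rfl | rfl
      · exact hry ▸ k0
      · exact (not_lt.2 hr hs1).elim
  · rcases hcov hz with (h | h) | h
    · exact Or.inl (Or.inl h)
    · exact Or.inr (Or.inl h)
    · obtain ⟨r, rfl⟩ := kr ▸ h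
      exact (le_total r s).imp (fun h => Or.inr ⟨r, h, rfl⟩) fun h => Or.inr ⟨r, h, rfl⟩
  · rcases h1 with h1 | ⟨r, hr, rfl⟩ <;> rcases h2 with h2 | ⟨r', hr', e⟩
    · exact disjoint_left.1 hAB h1 h2
    · rcases hend' r' (e ▸ hun ▸ Or.inl h1) with rfl | rfl
      · exact (not_lt.2 hr' hs0).elim
      · exact disjoint_left.1 hAB h1 (e ▸ k1)
    · rcases hend' r (hun ▸ Or.inr h2) with rfl | rfl
      · exact disjoint_left.1 hAB k0 h2
      · exact (not_lt.2 hr hs1).elim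
    · obtain rfl := ki e
      exact ks (le_antisymm (mem_Iic.1 hr) (mem_Ici.1 hr') ▸ hz)

end

/-! ### Crossing functions and the parametrization of irreducible continua -/

section

variable {G : Type u} [MetricSpace G] {x y : G} {M : Set G} {h : unitInterval → G}

/-- `φ` crosses the part `J` of `M`, from the value `0` at `x` to the value `1` at `y`, and is
locally constant elsewhere. -/
structure IsCrossing (x y : G) (M J : Set G) (φ : G → ℝ) : Prop where
  continuousOn : ContinuousOn φ M
  map_mem : ∀ p ∈ M, φ p ∈ Icc (0 : ℝ) 1
  left : φ x = 0
  right : φ y = 1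
  subset : J ⊆ M
  isPreconnected : IsPreconnected J
  injOn : InjOn φ J
  mem_iff : ∀ p ∈ M, φ p ∈ Ioo (0 : ℝ) 1 ↔ p ∈ J

/-- The function is 0 on the side of `x`, 1 on the side of `y`, and the arc parameter in between;
the three pieces are closed and agree where they meet, so they glue continuously. -/
theorem IsIrreducibleBetween.exists_isCrossing (hM : IsIrreducibleBetween x y M)
    (hc : Continuous h) (hi : Function.Injective h) (ho : IsOpen (h '' Ioo 0 1))
    (hx : x ∉ h '' Ioo 0 1) (hy : y ∉ h '' Ioo 0 1) (hne : (M ∩ h '' Ioo 0 1).Nonempty) :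
    ∃ φ, IsCrossing x y M (h '' Ioo 0 1) φ := by
  obtain ⟨k, kc, ki, kr, krM, A, B, hA, hB, hAB, hun, hxA, hyB, k0, k1⟩ :=
    hM.exists_separation hc hi ho hx hy hne
  have hI : h '' Ioo 0 1 = k '' Ioo 0 1 :=
    (image_Ioo_subset_of_range_subset kc ki hc hi kr.symm.subset).antisymm
      (image_Ioo_subset_of_range_subset hc hi kc ki kr.subset)
  rw [hI] at hun ho hne ⊢
  clear hI
  have hAI : ∀ p ∈ A, p ∉ k '' Ioo 0 1 := fun p hp => (hun.symm.subset (Or.inl hp)).2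
  have hBI : ∀ p ∈ B, p ∉ k '' Ioo 0 1 := fun p hp => (hun.symm.subset (Or.inr hp)).2
  have hend : ∀ r, k r ∉ k '' Ioo 0 1 → r = 0 ∨ r = 1 := fun r hr => by
    by_contra hn
    push Not at hn
    exact hr ⟨r, ⟨unitInterval.pos_iff_ne_zero.2 hn.1, unitInterval.lt_one_iff_ne_one.2 hn.2⟩, rfl⟩
  obtain ⟨ψ, hψ⟩ : ∃ ψ : G → unitInterval, ∀ s, ψ (k s) = s :=
    ⟨Function.invFun k, Function.leftInverse_invFun ki⟩
  classical
  let φ : G → ℝ := fun p => if p ∈ A then 0 else if p ∈ B then 1 else ψ p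
  have φA : ∀ p ∈ A, φ p = 0 := fun p hp => if_pos hp
  have φB : ∀ p ∈ B, φ p = 1 := fun p hp => by
    simp only [φ, if_neg (disjoint_right.1 hAB hp), if_pos hp]
  have φk : ∀ s, φ (k s) = s := fun s => by
    by_cases hsA : k s ∈ A
    · rcases hend s (hAI _ hsA) with rfl | rfl
      · simpa using φA _ hsA
      · exact (disjoint_left.1 hAB hsA k1).elim
    by_cases hsB : k s ∈ B
    · rcases hend s (hBI _ hsB) with rfl | rfl
      · exact (disjoint_left.1 hAB k0 hsB).elim
      · simpa using φB _ hsB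
    simp only [φ, if_neg hsA, if_neg hsB, hψ]
  have hcov : M ⊆ (A ∪ B) ∪ range k := fun z hz => by
    by_cases hzI : z ∈ k '' Ioo 0 1
    · exact Or.inr (image_subset_range _ _ hzI)
    · exact Or.inl (hun ▸ (⟨hz, hzI⟩ : z ∈ M \ k '' Ioo 0 1))
  refine ⟨φ, ?_, ?_, φA x hxA, φB y hyB, (image_subset_range _ _).trans krM,
    isPreconnected_image_Ioo kc, ?_, ?_⟩
  · refine ContinuousOn.mono ?_ hcov
    refine ((continuousOn_const.congr φA).union_of_isClosed (continuousOn_const.congr φB) hA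
      hB).union_of_isClosed ?_ (hA.union hB) (isCompact_range kc).isClosed
    have hemb := (kc.isClosedEmbedding ki).isEmbedding
    rw [← image_univ, hemb.isInducing.continuousOn_image_iff]
    exact (continuous_subtype_val.congr fun s => (φk s).symm).continuousOn
  · intro p hp
    rcases hcov hp with (hp | hp) | ⟨s, rfl⟩
    · simp [φA p hp]
    · simp [φB p hp]
    · rw [φk]; exact s.2
  · rintro _ ⟨s, -, rfl⟩ _ ⟨t, -, rfl⟩ e
    rw [φk, φk] at e
    rw [Subtype.ext e]
  · intro p hp
    rcases hcov hp with (hp | hp) | ⟨s, rfl⟩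
    · simp [φA p hp, hAI p hp]
    · simp [φB p hp, hBI p hp]
    · rw [φk, ki.mem_set_image]; rfl

theorem IsCrossing.compl {J : Set G} {φ : G → ℝ} (hφ : IsCrossing x y M J φ) :
    IsCrossing y x M J (fun p => 1 - φ p) where
  continuousOn := continuousOn_const.sub hφ.continuousOn
  map_mem p hp := ⟨by linarith [(hφ.map_mem p hp).2], by linarith [(hφ.map_mem p hp).1]⟩
  left := by simp [hφ.right]
  right := by simp [hφ.left]
  subset := hφ.subset
  isPreconnected := hφ.isPreconnected
  injOn p hp q hq e := hφ.injOn hp hq (by simpa using e)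
  mem_iff p hp := by
    rw [← hφ.mem_iff p hp]
    simp only [mem_Ioo, sub_pos, sub_lt_self_iff]
    exact and_comm

theorem IsCrossing.eq_zero_or_eq_one {J : Set G} {φ : G → ℝ} (hφ : IsCrossing x y M J φ) {p : G}
    (hp : p ∈ M) (hpJ : p ∉ J) : φ p = 0 ∨ φ p = 1 := by
  have h1 := hφ.map_mem p hp
  by_contra hn
  push Not at hn
  exact hpJ ((hφ.mem_iff p hp).1 ⟨lt_of_le_of_ne h1.1 hn.1.symm, lt_of_le_of_ne h1.2 hn.2⟩)

/-- A crossing function is constant on the connected sets which it does not cross. -/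
theorem IsCrossing.eq_of_disjoint {J J' : Set G} {φ : G → ℝ} (hφ : IsCrossing x y M J φ)
    (hJ' : IsPreconnected J') (hsub : J' ⊆ M) (hd : Disjoint J J') {p q : G} (hp : p ∈ J')
    (hq : q ∈ J') : φ p = φ q := by
  have hv : ∀ r ∈ J', φ r = 0 ∨ φ r = 1 := fun r hr =>
    hφ.eq_zero_or_eq_one (hsub hr) (disjoint_right.1 hd hr)
  have key : ∀ p ∈ J', ∀ q ∈ J', φ p = 0 → φ q = 1 → False := fun p hp q hq h0 h1 => by
    obtain ⟨r, hr, e⟩ := hJ'.intermediate_value hp hq (hφ.continuousOn.mono hsub)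
      (show (1 / 2 : ℝ) ∈ Icc (φ p) (φ q) by rw [h0, h1]; norm_num)
    rcases hv r hr with h | h <;> norm_num [h] at e
  rcases hv p hp with h | h <;> rcases hv q hq with h' | h'
  · rw [h, h']
  · exact (key p hp q hq h h').elim
  · exact (key q hq p hp h' h).elim
  · rw [h, h']

/-- All crossing functions order `M` compatibly. If `q` came before `p` for `φ₁` and after it for
`φ₂`, then `φ₂` would vanish on `J₁`, that is, `J₁` would come before `J₂`; in either position of
`J₂` relative to `J₁`, level sets of `φ₁` and `φ₂` then disconnect `M`. -/
theorem IsCrossing.le_of_lt {J₁ J₂ : Set G} {φ₁ φ₂ : G → ℝ} (h₁ : IsCrossing x y M J₁ φ₁)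
    (h₂ : IsCrossing x y M J₂ φ₂) (hM : IsPreconnected M) (hx : x ∈ M) (hy : y ∈ M)
    (hMc : IsClosed M) (hd : Disjoint J₁ J₂) {p q : G} (hp : p ∈ J₁) (hq : q ∈ M)
    (hlt : φ₁ q < φ₁ p) : φ₂ q ≤ φ₂ p := by
  by_contra! hlt₂
  have hpM := h₁.subset hp
  have hp1 := (h₁.mem_iff p hpM).2 hp
  have hp0 : φ₂ p = 0 := (h₂.eq_zero_or_eq_one hpM (disjoint_left.1 hd hp)).resolve_right
    fun e => by linarith [(h₂.map_mem q hq).2]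
  have hJ1 : ∀ r ∈ M, 0 < φ₁ r → φ₁ r < 1 → φ₂ r = 0 := fun r hr h0 h1 =>
    (h₂.eq_of_disjoint h₁.isPreconnected h₁.subset hd.symm ((h₁.mem_iff r hr).1 ⟨h0, h1⟩) hp).trans
      hp0
  have hcl : ∀ (T : Set ℝ) {φ : G → ℝ}, ContinuousOn φ M → IsClosed T → IsClosed (M ∩ φ ⁻¹' T) :=
    fun T φ hφ hT => hφ.preimage_isClosed_of_isClosed hMc hT
  -- Here `φ₁` is 1 on all of `J₂`. The point `q` has `φ₁ q = 0` and `φ₂ q = 1`, and the set of all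
  -- such points splits off from the rest of `M`, which contains `x`.
  by_cases hone : ∀ r ∈ M, 0 < φ₂ r → φ₂ r < 1 → φ₁ r = 1
  · have := subset_of_isPreconnected_of_isClosed hM (A := M ∩ φ₁ ⁻¹' Iic 0 ∩ (M ∩ φ₂ ⁻¹' Ici 1))
      (B := M ∩ φ₁ ⁻¹' Ici (φ₁ p) ∪ M ∩ φ₂ ⁻¹' Iic 0) (p := q)
      ((hcl _ h₁.continuousOn isClosed_Iic).inter (hcl _ h₂.continuousOn isClosed_Ici))
      ((hcl _ h₁.continuousOn isClosed_Ici).union (hcl _ h₂.continuousOn isClosed_Iic)) ?_ ?_ hq ?_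
      hx
    · have h := this.2.2
      rw [mem_preimage, h₂.left, mem_Ici] at h
      linarith
    · intro r hr
      have a1 := h₁.map_mem r hr
      have a2 := h₂.map_mem r hr
      have := hJ1 r hr
      have := hone r hr
      simp only [mem_union, mem_inter_iff, mem_preimage, mem_Iic, mem_Ici, hr, true_and]
      rw [mem_Icc] at a1 a2
      rw [mem_Ioo] at hp1
      grind
    · intro r hr a b
      simp only [mem_union, mem_inter_iff, mem_preimage, mem_Iic, mem_Ici, hr, true_and] at a b
      rw [mem_Ioo] at hp1
      grind
    · have a1 := h₁.map_mem q hq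
      have a2 := h₂.map_mem q hq
      have := hJ1 q hq
      have := hone q hq
      simp only [mem_inter_iff, mem_preimage, mem_Iic, mem_Ici, hq, true_and]
      rw [mem_Icc] at a1 a2
      rw [mem_Ioo] at hp1
      grind
  -- Here `φ₁` is 0 on `J₂`, so each of `J₁`, `J₂` comes before the other. The points where both
  -- functions are 1 include `y` and split off from the rest, which contains `x`.
  · push Not at hone
    obtain ⟨r₀, hr₀, a0, a1, ane⟩ := hone
    have hr₀J := (h₂.mem_iff r₀ hr₀).1 ⟨a0, a1⟩
    have hr₀' : φ₁ r₀ = 0 := (h₁.eq_zero_or_eq_one hr₀ (disjoint_right.1 hd hr₀J)).resolve_right ane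
    have hJ2 : ∀ r ∈ M, 0 < φ₂ r → φ₂ r < 1 → φ₁ r = 0 := fun r hr h0 h1 =>
      (h₁.eq_of_disjoint h₂.isPreconnected h₂.subset hd ((h₂.mem_iff r hr).1 ⟨h0, h1⟩) hr₀J).trans
        hr₀'
    have := subset_of_isPreconnected_of_isClosed hM (A := M ∩ φ₁ ⁻¹' Ici 1 ∩ (M ∩ φ₂ ⁻¹' Ici 1))
      (B := M ∩ φ₁ ⁻¹' Iic (φ₁ p) ∪ M ∩ φ₂ ⁻¹' Iic 0) (p := y)
      ((hcl _ h₁.continuousOn isClosed_Ici).inter (hcl _ h₂.continuousOn isClosed_Ici))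
      ((hcl _ h₁.continuousOn isClosed_Iic).union (hcl _ h₂.continuousOn isClosed_Iic)) ?_ ?_ hy
      ⟨⟨hy, h₁.right.ge⟩, hy, h₂.right.ge⟩ hx
    · have h := this.2.2
      rw [mem_preimage, h₂.left, mem_Ici] at h
      linarith
    · intro r hr
      have a1 := h₁.map_mem r hr
      have a2 := h₂.map_mem r hr
      have := hJ1 r hr
      have := hJ2 r hr
      simp only [mem_union, mem_inter_iff, mem_preimage, mem_Iic, mem_Ici, hr, true_and]
      rw [mem_Icc] at a1 a2
      rw [mem_Ioo] at hp1
      grind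
    · intro r hr a b
      simp only [mem_union, mem_inter_iff, mem_preimage, mem_Iic, mem_Ici, hr, true_and] at a b
      rw [mem_Ioo] at hp1
      grind

theorem IsCrossing.le_of_gt {J₁ J₂ : Set G} {φ₁ φ₂ : G → ℝ} (h₁ : IsCrossing x y M J₁ φ₁)
    (h₂ : IsCrossing x y M J₂ φ₂) (hM : IsPreconnected M) (hx : x ∈ M) (hy : y ∈ M)
    (hMc : IsClosed M) (hd : Disjoint J₁ J₂) {p q : G} (hp : p ∈ J₁) (hq : q ∈ M)
    (hlt : φ₁ p < φ₁ q) : φ₂ p ≤ φ₂ q := by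
  have := h₁.compl.le_of_lt h₂.compl hM hy hx hMc hd hp hq (by linarith)
  linarith

/-- A continuous real function on a continuum which is injective up to a countable set of points
is injective. -/
theorem injOn_of_injOn_compl_countable (hM : IsCompact M) (hMp : IsPreconnected M) {φ : G → ℝ}
    (hφ : ContinuousOn φ M) {Q : Set G} (hQ : Q.Countable)
    (hinj : ∀ p ∈ M, p ∉ Q → ∀ q ∈ M, φ p = φ q → p = q) : InjOn φ M := by
  intro p hp q hq hpq
  by_contra hne
  have hF : ∀ z ∈ M, φ z = φ p → z ∈ Q := fun z hz hzp => by
    by_contra hzQ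
    exact hne ((hinj z hz hzQ p hp hzp).symm.trans (hinj z hz hzQ q hq (hzp.trans hpq)))
  -- a sphere around `p` avoiding the fibre
  obtain ⟨r, ⟨hr0, hrd⟩, hr⟩ : ∃ r ∈ Ioo 0 (dist q p), r ∉ (fun z => dist z p) '' Q := by
    by_contra! hn
    have h2 := (hQ.image (fun z => dist z p)).mono hn
    rw [← Cardinal.le_aleph0_iff_set_countable, Cardinal.mk_Ioo_real
      (dist_pos.2 (Ne.symm hne))] at h2
    exact Cardinal.aleph0_lt_continuum.not_ge h2
  have hSc : IsCompact (φ '' (M ∩ Metric.sphere p r)) :=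
    (hM.inter_right Metric.isClosed_sphere).image_of_continuousOn (hφ.mono inter_subset_left)
  have hφp : φ p ∉ φ '' (M ∩ Metric.sphere p r) := by
    rintro ⟨z, ⟨hz, hzr⟩, e⟩
    exact hr ⟨z, hF z hz e, hzr⟩
  obtain ⟨ε, hε, hball⟩ := Metric.isOpen_iff.1 hSc.isClosed.isOpen_compl _ hφp
  have hval : ∀ l u : ℝ, l < u → ∃ a ∈ Ioo l u, a ∉ φ '' Q := fun l u hlu => by
    by_contra! hn
    have h2 := (hQ.image φ).mono hn
    rw [← Cardinal.le_aleph0_iff_set_countable, Cardinal.mk_Ioo_real hlu] at h2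
    exact Cardinal.aleph0_lt_continuum.not_ge h2
  -- Levels outside `φ '' Q` have at most one point of `M` in their fibre.
  obtain ⟨a, ⟨ha1, ha2⟩, haQ⟩ := hval (φ p - ε) (φ p) (by linarith)
  obtain ⟨b, ⟨hb1, hb2⟩, hbQ⟩ := hval (φ p) (φ p + ε) (by linarith)
  have hsph : ∀ z ∈ M, a ≤ φ z → φ z ≤ b → dist z p ≠ r := fun z hz h1 h2 e =>
    hball (show φ z ∈ Metric.ball (φ p) ε by
      rw [Metric.mem_ball, Real.dist_eq, abs_lt]; constructor <;> linarith) ⟨z, ⟨hz, e⟩, rfl⟩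
  have huniq : ∀ c, c ∉ φ '' Q → ∀ z ∈ M, ∀ z' ∈ M, φ z = c → φ z' = c → z = z' :=
    fun c hc z hz z' hz' e e' => hinj z hz (fun hzQ => hc ⟨z, hzQ, e⟩) z' hz' (e.trans e'.symm)
  have hcl : ∀ T : Set ℝ, IsClosed T → IsClosed (M ∩ φ ⁻¹' T) :=
    fun T hT => hφ.preimage_isClosed_of_isClosed hM.isClosed hT
  -- `α` and `β` record whether the only possible point at level `a`, resp. `b`, is inside the ball.
  -- They decide to which side the whole of `φ ≤ a`, resp. `φ ≥ b`, is attached, so that the two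
  -- closed sets below are disjoint on `M`, with `p` in one and `q` in the other.
  obtain ⟨α, hα⟩ : ∃ α : Prop, α ↔ ∃ z ∈ M, φ z = a ∧ dist z p ≤ r := ⟨_, Iff.rfl⟩
  obtain ⟨β, hβ⟩ : ∃ β : Prop, β ↔ ∃ z ∈ M, φ z = b ∧ dist z p ≤ r := ⟨_, Iff.rfl⟩
  have hcst : ∀ c : Prop, IsClosed {_z : G | c} := fun c => isClosed_const
  have hd1 : IsClosed {z : G | dist z p ≤ r} :=
    isClosed_le (continuous_id.dist continuous_const) continuous_const
  have hd2 : IsClosed {z : G | r ≤ dist z p} :=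
    isClosed_le continuous_const (continuous_id.dist continuous_const)
  have hsub := subset_of_isPreconnected_of_isClosed hMp (p := p)
    (A := (M ∩ φ ⁻¹' Icc a b ∩ {z | dist z p ≤ r}) ∪ (M ∩ φ ⁻¹' Iic a ∩ {_z | α}) ∪
      (M ∩ φ ⁻¹' Ici b ∩ {_z | β}))
    (B := (M ∩ φ ⁻¹' Icc a b ∩ {z | r ≤ dist z p}) ∪ (M ∩ φ ⁻¹' Iic a ∩ {_z | ¬ α}) ∪
      (M ∩ φ ⁻¹' Ici b ∩ {_z | ¬ β}))
    ((((hcl _ isClosed_Icc).inter hd1).union ((hcl _ isClosed_Iic).inter (hcst _))).union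
      ((hcl _ isClosed_Ici).inter (hcst _)))
    ((((hcl _ isClosed_Icc).inter hd2).union ((hcl _ isClosed_Iic).inter (hcst _))).union
      ((hcl _ isClosed_Ici).inter (hcst _))) ?_ ?_ hp
    (Or.inl (Or.inl ⟨⟨hp, ha2.le, hb1.le⟩, by simpa using hr0.le⟩)) hq
  · rcases hsub with (h | h) | h
    · exact (not_le.2 hrd) h.2
    · exact (not_le.2 (hpq ▸ ha2)) h.1.2
    · exact (not_le.2 (hpq ▸ hb1)) h.1.2
  · intro z hz
    simp only [mem_union, mem_inter_iff, mem_preimage, mem_Icc, mem_Iic, mem_Ici, hz, true_and,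
      mem_ofPred_eq]
    rcases le_total (φ z) a with h1 | h1
    · exact (em α).imp (fun h => Or.inl (Or.inr ⟨h1, h⟩)) fun h => Or.inl (Or.inr ⟨h1, h⟩)
    rcases le_total b (φ z) with h2 | h2
    · exact (em β).imp (fun h => Or.inr ⟨h2, h⟩) fun h => Or.inr ⟨h2, h⟩
    exact (le_total (dist z p) r).imp (fun h => Or.inl (Or.inl ⟨⟨h1, h2⟩, h⟩))
      fun h => Or.inl (Or.inl ⟨⟨h1, h2⟩, h⟩)
  · intro z hz h1 h2
    simp only [mem_union, mem_inter_iff, mem_preimage, mem_Icc, mem_Iic, mem_Ici, hz, true_and,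
      mem_ofPred_eq] at h1 h2
    rcases h1 with (⟨⟨h1, h1'⟩, h1''⟩ | ⟨h1, h1'⟩) | ⟨h1, h1'⟩ <;>
      rcases h2 with (⟨⟨h2, h2'⟩, h2''⟩ | ⟨h2, h2'⟩) | ⟨h2, h2'⟩
    · exact hsph z hz h1 h1' (le_antisymm h1'' h2'')
    · exact h2' (hα.2 ⟨z, hz, le_antisymm h2 h1, h1''⟩)
    · exact h2' (hβ.2 ⟨z, hz, le_antisymm h1' h2, h1''⟩)
    · obtain ⟨z', hz', e, hd⟩ := hα.1 h1'
      obtain rfl := huniq a haQ z hz z' hz' (le_antisymm h1 h2) e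
      exact hsph z hz h2 h2' (le_antisymm hd h2'')
    · exact h2' h1'
    · linarith
    · obtain ⟨z', hz', e, hd⟩ := hβ.1 h1'
      obtain rfl := huniq b hbQ z hz z' hz' (le_antisymm h2' h1) e
      exact hsph z hz h2 h2' (le_antisymm hd h2'')
    · linarith
    · exact h2' h1'

theorem isArcBetween_of_injOn (hM : IsCompact M) (hMp : IsPreconnected M) {φ : G → ℝ}
    (hφ : ContinuousOn φ M) (hinj : InjOn φ M) (hx : x ∈ M) (hy : y ∈ M) (hxy : x ≠ y)
    (hle : ∀ p ∈ M, φ x ≤ φ p ∧ φ p ≤ φ y) : IsArcBetween x y M := by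
  have hlt : φ x < φ y := lt_of_le_of_ne (hle y hy).1 fun e => hxy (hinj hx hy e)
  have hpos : 0 < φ y - φ x := sub_pos.2 hlt
  have : CompactSpace M := isCompact_iff_compactSpace.1 hM
  let ψ : M → unitInterval := fun p => ⟨(φ p - φ x) / (φ y - φ x),
    div_nonneg (sub_nonneg.2 (hle p p.2).1) hpos.le,
    (div_le_one hpos).2 (sub_le_sub_right (hle p p.2).2 _)⟩
  have ψc : Continuous ψ :=
    ((hφ.domRestrict.sub continuous_const).div_const _).subtype_mk _
  have ψb : Function.Bijective ψ := by
    constructor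
    · intro p q e
      have := congrArg Subtype.val e
      simp only [ψ] at this
      rw [div_left_inj' hpos.ne'] at this
      exact Subtype.ext (hinj p.2 q.2 (by linarith))
    · rintro ⟨s, hs0, hs1⟩
      obtain ⟨p, hp, e⟩ := hMp.intermediate_value hx hy hφ
        (show φ x + s * (φ y - φ x) ∈ Icc (φ x) (φ y) by constructor <;> nlinarith)
      refine ⟨⟨p, hp⟩, Subtype.ext ?_⟩
      simp only [ψ, e]
      field_simp
      ring
  let e := Continuous.homeoOfEquivCompactToT2 (f := Equiv.ofBijective ψ ψb) ψc
  have h0 : e ⟨x, hx⟩ = 0 := Subtype.ext (by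
    change (φ x - φ x) / (φ y - φ x) = 0
    simp)
  have h1 : e ⟨y, hy⟩ = 1 := Subtype.ext (by
    change (φ y - φ x) / (φ y - φ x) = 1
    exact div_self hpos.ne')
  refine ⟨fun s => (e.symm s : G), continuous_subtype_val.comp e.symm.continuous,
    Subtype.val_injective.comp e.symm.injective, ?_, ?_, ?_⟩
  · change range (Subtype.val ∘ e.symm) = M
    rw [e.symm.surjective.range_comp, Subtype.range_coe]
  · simp only [← h0, e.symm_apply_apply]
  · simp only [← h1, e.symm_apply_apply]

end

/-! ### Arcwise connectedness from countable families of free arcs -/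

section

variable {G : Type u} [MetricSpace G]

/-- A family of parametrized free arcs with disjoint interiors, covering the space up to a
countable set. -/
structure IsArcFamily {ι : Type*} (h : ι → unitInterval → G) : Prop where
  continuous : ∀ w, Continuous (h w)
  injective : ∀ w, Function.Injective (h w)
  isOpen : ∀ w, IsOpen (h w '' Ioo 0 1)
  disjoint : ∀ w w', w ≠ w' → Disjoint (h w '' Ioo 0 1) (h w' '' Ioo 0 1)
  countable_compl : (⋃ w, h w '' Ioo 0 1)ᶜ.Countable

/-- The irreducible subcontinuum is itself the arc, with a sum of crossing functions as coordinate.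
-/
theorem exists_isArcBetween_subset {ι : Type*} [Countable ι] {h : ι → unitInterval → G}
    (hh : IsArcFamily h) {x y : G} (hx : ∀ w, x ∉ h w '' Ioo 0 1) (hy : ∀ w, y ∉ h w '' Ioo 0 1)
    {K : Set G} (hc : IsCompact K) (hK : IsPreconnected K) (hxK : x ∈ K) (hyK : y ∈ K)
    (hxy : x ≠ y) : ∃ γ ⊆ K, IsArcBetween x y γ := by
  obtain ⟨M, hMK, hM⟩ := exists_isIrreducibleBetween hc hK hxK hyK
  refine ⟨M, hMK, ?_⟩
  let κ := {w : ι // (M ∩ h w '' Ioo 0 1).Nonempty}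
  choose φ hφ using fun w : κ => hM.exists_isCrossing (hh.continuous w) (hh.injective w)
    (hh.isOpen w) (hx w) (hy w) w.2
  have : Encodable κ := Encodable.ofCountable κ
  -- Positive summable weights make the series of crossing functions converge uniformly.
  obtain ⟨c, cpos, C, hC, -⟩ := posSumOfEncodable one_pos κ
  have hsum : ∀ p ∈ M, Summable fun w => c w * φ w p := fun p hp =>
    hC.summable.of_nonneg_of_le (fun w => mul_nonneg (cpos w).le ((hφ w).map_mem p hp).1)
      fun w => mul_le_of_le_one_right (cpos w).le ((hφ w).map_mem p hp).2
  let Φ : G → ℝ := fun p => ∑' w, c w * φ w p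
  have Φc : ContinuousOn Φ M := continuousOn_tsum
    (fun w => continuousOn_const.mul (hφ w).continuousOn) hC.summable (fun w p hp => by
      rw [Real.norm_of_nonneg (mul_nonneg (cpos w).le ((hφ w).map_mem p hp).1)]
      exact mul_le_of_le_one_right (cpos w).le ((hφ w).map_mem p hp).2)
  have hinj : ∀ p ∈ M, p ∉ (⋃ w, h w '' Ioo 0 1)ᶜ → ∀ q ∈ M, Φ p = Φ q → p = q := by
    intro p hp hpQ q hq e
    rw [notMem_compl_iff, mem_iUnion] at hpQ
    obtain ⟨w₀, hw₀⟩ := hpQ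
    let w : κ := ⟨w₀, p, hp, hw₀⟩
    have hd : ∀ w' : κ, w' ≠ w → Disjoint (h w '' Ioo 0 1) (h w' '' Ioo 0 1) := fun w' hw' =>
      hh.disjoint _ _ fun e => hw' (Subtype.ext e.symm)
    -- For `p` inside the arc `w`, the function `φ w` tells `p` from every other point of `M`, and
    -- no other crossing function orders the two points the opposite way, so the sum is strictly
    -- monotone there.
    rcases lt_trichotomy (φ w q) (φ w p) with hlt | heq | hlt
    · refine absurd e (ne_of_gt ((hsum q hq).tsum_lt_tsum (i := w) (fun w' => ?_) ?_ (hsum p hp)))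
      · refine mul_le_mul_of_nonneg_left ?_ (cpos w').le
        by_cases hw' : w' = w
        · rw [hw']; exact hlt.le
        · exact (hφ w).le_of_lt (hφ w') hM.isPreconnected hM.left_mem hM.right_mem
            hM.isCompact.isClosed (hd w' hw') hw₀ hq hlt
      · exact mul_lt_mul_of_pos_left hlt (cpos w)
    · refine (hφ w).injOn hw₀ (((hφ w).mem_iff q hq).1 ?_) heq.symm
      rw [heq]
      exact ((hφ w).mem_iff p hp).2 hw₀
    · refine absurd e (ne_of_lt ((hsum p hp).tsum_lt_tsum (i := w) (fun w' => ?_) ?_ (hsum q hq)))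
      · refine mul_le_mul_of_nonneg_left ?_ (cpos w').le
        by_cases hw' : w' = w
        · rw [hw']; exact hlt.le
        · exact (hφ w).le_of_gt (hφ w') hM.isPreconnected hM.left_mem hM.right_mem
            hM.isCompact.isClosed (hd w' hw') hw₀ hq hlt
      · exact mul_lt_mul_of_pos_left hlt (cpos w)
  refine isArcBetween_of_injOn hM.isCompact hM.isPreconnected Φc
    (injOn_of_injOn_compl_countable hM.isCompact hM.isPreconnected Φc hh.countable_compl hinj)
    hM.left_mem hM.right_mem hxy fun p hp => ⟨?_, ?_⟩
  · refine (hsum x hM.left_mem).tsum_le_tsum (fun w => ?_) (hsum p hp)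
    rw [(hφ w).left]
    exact mul_le_mul_of_nonneg_left ((hφ w).map_mem p hp).1 (cpos w).le
  · refine (hsum p hp).tsum_le_tsum (fun w => ?_) (hsum y hM.right_mem)
    rw [(hφ w).right]
    exact mul_le_mul_of_nonneg_left ((hφ w).map_mem p hp).2 (cpos w).le

theorem exists_reparam_Ioo {a b : unitInterval} (hab : a < b) :
    ∃ θ : unitInterval → unitInterval, Continuous θ ∧ Function.Injective θ ∧
      θ '' Ioo 0 1 = Ioo a b := by
  have hpos : (0 : ℝ) < b - a := sub_pos.2 hab
  have ha := a.2
  have hb := b.2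
  refine ⟨fun s => ⟨a + (b - a) * s, ?_, ?_⟩, ?_, ?_, ?_⟩
  · nlinarith [s.2.1, ha.1]
  · nlinarith [s.2.2, s.2.1, hb.2]
  · fun_prop
  · intro s t e
    have := congrArg Subtype.val e
    simp only [add_right_inj, mul_eq_mul_left_iff, hpos.ne', or_false] at this
    exact Subtype.ext this
  · ext r
    constructor
    · rintro ⟨s, ⟨hs0, hs1⟩, rfl⟩
      have hs0' : (0 : ℝ) < s := hs0
      have hs1' : (s : ℝ) < 1 := hs1
      constructor
      · change (a : ℝ) < a + (b - a) * s
        nlinarith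
      · change (a + (b - a) * s : ℝ) < b
        nlinarith
    · rintro ⟨har, hrb⟩
      have har' : (a : ℝ) < r := har
      have hrb' : (r : ℝ) < b := hrb
      have h0 : 0 < ((r - a) / (b - a) : ℝ) := div_pos (by linarith) hpos
      have h1 : ((r - a) / (b - a) : ℝ) < 1 := (div_lt_one hpos).2 (by linarith)
      refine ⟨⟨(r - a) / (b - a), h0.le, h1.le⟩, ⟨h0, h1⟩, Subtype.ext ?_⟩
      simp only
      field_simp
      ring

/-- The previous construction needs end points outside all open arcs. An arc through `x` is cut at
`x`: its old index keeps the first half and `none` indexes the second. -/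
theorem IsArcFamily.exists_split {ι : Type u} [Countable ι] {h : ι → unitInterval → G}
    (hh : IsArcFamily h) (x : G) :
    ∃ (ι' : Type u) (_ : Countable ι') (h' : ι' → unitInterval → G), IsArcFamily h' ∧
      (∀ w, x ∉ h' w '' Ioo 0 1) ∧
      ∀ z, (∀ w, z ∉ h w '' Ioo 0 1) → ∀ w, z ∉ h' w '' Ioo 0 1 := by
  by_cases hx : ∀ w, x ∉ h w '' Ioo 0 1
  · exact ⟨ι, inferInstance, h, hh, hx, fun z hz => hz⟩
  push Not at hx
  obtain ⟨w₀, t, ht, rfl⟩ := hx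
  obtain ⟨θ₁, c₁, i₁, e₁⟩ := exists_reparam_Ioo ht.1
  obtain ⟨θ₂, c₂, i₂, e₂⟩ := exists_reparam_Ioo ht.2
  classical
  let h' : Option ι → unitInterval → G := fun o =>
    o.elim (h w₀ ∘ θ₂) fun w => if w = w₀ then h w₀ ∘ θ₁ else h w
  have hn : h' none = h w₀ ∘ θ₂ := rfl
  have hs₀ : h' (some w₀) = h w₀ ∘ θ₁ := if_pos rfl
  have hs : ∀ w, w ≠ w₀ → h' (some w) = h w := fun w hw => if_neg hw
  have In : h' none '' Ioo 0 1 = h w₀ '' Ioo t 1 := by rw [hn, image_comp, e₂]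
  have Is₀ : h' (some w₀) '' Ioo 0 1 = h w₀ '' Ioo 0 t := by rw [hs₀, image_comp, e₁]
  have sub₂ : Ioo t 1 ⊆ Ioo 0 1 := Ioo_subset_Ioo_left ht.1.le
  have sub₁ : Ioo 0 t ⊆ Ioo 0 1 := Ioo_subset_Ioo_right ht.2.le
  have hdis : ∀ w, w ≠ w₀ → Disjoint (h' none '' Ioo 0 1) (h w '' Ioo 0 1) ∧
      Disjoint (h' (some w₀) '' Ioo 0 1) (h w '' Ioo 0 1) := fun w hw => by
    rw [In, Is₀]
    exact ⟨(hh.disjoint _ _ hw.symm).mono_left (image_mono sub₂),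
      (hh.disjoint _ _ hw.symm).mono_left (image_mono sub₁)⟩
  have hdis₀ : Disjoint (h' none '' Ioo 0 1) (h' (some w₀) '' Ioo 0 1) := by
    rw [In, Is₀, disjoint_image_iff (hh.injective w₀), disjoint_left]
    exact fun s h1 h2 => lt_asymm h1.1 h2.2
  have hsub : ∀ o, ∃ w, h' o '' Ioo 0 1 ⊆ h w '' Ioo 0 1 := by
    rintro (_ | w)
    · exact ⟨w₀, In ▸ image_mono sub₂⟩
    · by_cases hw : w = w₀
      · exact ⟨w₀, by rw [hw, Is₀]; exact image_mono sub₁⟩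
      · exact ⟨w, by rw [hs w hw]⟩
  refine ⟨Option ι, inferInstance, h', ⟨?_, ?_, ?_, ?_, ?_⟩, ?_, ?_⟩
  · rintro (_ | w)
    · rw [hn]; exact (hh.continuous _).comp c₂
    · by_cases hw : w = w₀
      · rw [hw, hs₀]; exact (hh.continuous _).comp c₁
      · rw [hs w hw]; exact hh.continuous w
  · rintro (_ | w)
    · rw [hn]; exact (hh.injective _).comp i₂
    · by_cases hw : w = w₀
      · rw [hw, hs₀]; exact (hh.injective _).comp i₁
      · rw [hs w hw]; exact hh.injective w
  · rintro (_ | w)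
    · rw [In]
      exact isOpen_image_of_subset_Ioo (hh.continuous _) (hh.injective _) (hh.isOpen _)
        isOpen_Ioo sub₂
    · by_cases hw : w = w₀
      · rw [hw, Is₀]
        exact isOpen_image_of_subset_Ioo (hh.continuous _) (hh.injective _) (hh.isOpen _)
          isOpen_Ioo sub₁
      · rw [hs w hw]; exact hh.isOpen w
  · rintro (_ | w) (_ | w') hne
    · exact (hne rfl).elim
    · by_cases hw : w' = w₀
      · rw [hw]; exact hdis₀
      · rw [hs w' hw]; exact (hdis w' hw).1
    · by_cases hw : w = w₀
      · rw [hw]; exact hdis₀.symm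
      · rw [hs w hw]; exact (hdis w hw).1.symm
    · by_cases hw : w = w₀ <;> by_cases hw' : w' = w₀
      · exact (hne (by rw [hw, hw'])).elim
      · rw [hw, hs w' hw']; exact (hdis w' hw').2
      · rw [hw', hs w hw]; exact (hdis w hw).2.symm
      · rw [hs w hw, hs w' hw']; exact hh.disjoint _ _ fun e => hne (by rw [e])
  · refine (hh.countable_compl.union (countable_singleton (h w₀ t))).mono fun z hz => ?_
    by_contra hn
    simp only [mem_union, mem_compl_iff, mem_iUnion, not_or, not_not, mem_singleton_iff] at hn hz
    obtain ⟨⟨w, hw⟩, hzt⟩ := hn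
    refine hz ?_
    by_cases hww : w = w₀
    · obtain ⟨s, hs', rfl⟩ := hw
      rw [hww] at hzt ⊢
      rcases lt_trichotomy s t with hst | hst | hst
      · exact ⟨some w₀, Is₀ ▸ ⟨s, ⟨hs'.1, hst⟩, rfl⟩⟩
      · exact (hzt (by rw [hst])).elim
      · exact ⟨none, In ▸ ⟨s, ⟨hst, hs'.2⟩, rfl⟩⟩
    · exact ⟨some w, by rwa [hs w hww]⟩
  · rintro (_ | w)
    · rw [In, (hh.injective w₀).mem_set_image]; exact fun h => lt_irrefl _ h.1
    · by_cases hw : w = w₀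
      · rw [hw, Is₀, (hh.injective w₀).mem_set_image]; exact fun h => lt_irrefl _ h.2
      · rw [hs w hw]
        exact disjoint_left.1 (hh.disjoint w₀ w (Ne.symm hw)) ⟨t, ht, rfl⟩
  · intro z hz o hzo
    obtain ⟨w, hw⟩ := hsub o
    exact hz w (hw hzo)

/-- Every subcontinuum of a space with a countable family of free arcs whose interiors cover all
but countably many points is arcwise connected. -/
theorem IsArcFamily.exists_isArcBetween {ι : Type u} [Countable ι] {h : ι → unitInterval → G}
    (hh : IsArcFamily h) {K : Set G} (hc : IsCompact K) (hK : IsPreconnected K) {x y : G}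
    (hx : x ∈ K) (hy : y ∈ K) (hxy : x ≠ y) : ∃ γ ⊆ K, IsArcBetween x y γ := by
  obtain ⟨ι₁, _, h₁, hh₁, hx₁, -⟩ := hh.exists_split x
  obtain ⟨ι₂, _, h₂, hh₂, hy₂, hkeep⟩ := hh₁.exists_split y
  exact exists_isArcBetween_subset hh₂ (hkeep x hx₁) hy₂ hc hK hx hy hxy

end

/-! ### Markov families -/

section

variable {G : Type u} {ι : Type u}

/-- A parametrized Markov partition. -/
structure IsMarkovFamily [MetricSpace G] (f : G → G) (h : ι → unitInterval → G) : Prop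
    extends IsArcFamily h where
  continuous_map : Continuous f
  injOn : ∀ i, InjOn f (range (h i))
  markov : ∀ i j, (f '' range (h i) ∩ h j '' Ioo 0 1).Nonempty → range (h j) ⊆ f '' range (h i)
  mixing : IsTopMixing f

/-- The arc `i` covers the arc `j`. -/
def Covers (f : G → G) (h : ι → unitInterval → G) (i j : ι) : Prop :=
  range (h j) ⊆ f '' range (h i)

/-- The complement of the interiors of the partition arcs. -/
def exceptional (h : ι → unitInterval → G) : Set G := (⋃ i, h i '' Ioo 0 1)ᶜ

/-- The points with itinerary `s` up to time `n`. -/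
def cyl (f : G → G) (h : ι → unitInterval → G) (s : ℕ → ι) (n : ℕ) : Set G :=
  {p | ∀ k ≤ n, f^[k] p ∈ range (h (s k))}

/-- The points passing through the interiors of the arcs of the itinerary `s` up to time `n`. -/
def cylInt (f : G → G) (h : ι → unitInterval → G) (s : ℕ → ι) (n : ℕ) : Set G :=
  {p | ∀ k ≤ n, f^[k] p ∈ h (s k) '' Ioo 0 1}

theorem notMem_exceptional {h : ι → unitInterval → G} {p : G} :
    p ∉ exceptional h ↔ ∃ i, p ∈ h i '' Ioo 0 1 := by
  rw [exceptional, notMem_compl_iff, mem_iUnion]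

theorem cyl_antitone (f : G → G) (h : ι → unitInterval → G) (s : ℕ → ι) : Antitone (cyl f h s) :=
  fun _ _ hmn _ hp k hk => hp k (hk.trans hmn)

theorem cyl_congr (f : G → G) (h : ι → unitInterval → G) {s t : ℕ → ι} {n : ℕ}
    (hst : ∀ k ≤ n, s k = t k) : cyl f h s n = cyl f h t n := by
  ext p
  exact forall₂_congr fun k hk => by rw [hst k hk]

theorem cyl_succ (f : G → G) (h : ι → unitInterval → G) (s : ℕ → ι) (n : ℕ) :
    cyl f h s (n + 1) = cyl f h s n ∩ f^[n + 1] ⁻¹' range (h (s (n + 1))) := by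
  ext p
  constructor
  · exact fun hp => ⟨fun k hk => hp k (by omega), hp _ le_rfl⟩
  · rintro ⟨h1, h2⟩ k hk
    rcases Nat.lt_or_ge n k with hk' | hk'
    · obtain rfl : k = n + 1 := by omega
      exact h2
    · exact h1 k hk'

variable [MetricSpace G] {f : G → G} {h : ι → unitInterval → G}

theorem IsArcFamily.eq_of_mem (hh : IsArcFamily h) {i j : ι} {p : G} (hi : p ∈ h i '' Ioo 0 1)
    (hj : p ∈ h j '' Ioo 0 1) : i = j := by
  by_contra hne
  exact disjoint_left.1 (hh.disjoint i j hne) hi hj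

/-- An arc is the closure of its open part, so if it meets another open arc, the open parts meet. -/
theorem IsArcFamily.eq_of_mem_range (hh : IsArcFamily h) {i j : ι} {p : G}
    (hi : p ∈ range (h i)) (hj : p ∈ h j '' Ioo 0 1) : i = j := by
  rw [← closure_image_Ioo (hh.continuous i)] at hi
  obtain ⟨q, hqj, hqi⟩ := mem_closure_iff.1 hi _ (hh.isOpen j) hj
  exact hh.eq_of_mem hqi hqj

theorem IsArcFamily.mem_image_Ioo (hh : IsArcFamily h) {i : ι} {p : G}
    (hi : p ∈ range (h i)) (hp : p ∉ exceptional h) : p ∈ h i '' Ioo 0 1 := by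
  obtain ⟨j, hj⟩ := notMem_exceptional.1 hp
  rwa [hh.eq_of_mem_range hi hj]

theorem IsArcFamily.countable_exceptional (hh : IsArcFamily h) : (exceptional h).Countable :=
  hh.countable_compl

theorem IsArcFamily.nontrivial [Nonempty ι] (hh : IsArcFamily h) : Nontrivial G :=
  (hh.injective (Classical.arbitrary ι)).nontrivial

theorem IsArcFamily.dense_compl_exceptional [ConnectedSpace G] [Nonempty ι]
    (hh : IsArcFamily h) : Dense (exceptional h)ᶜ :=
  have := hh.nontrivial
  dense_compl_of_countable hh.countable_exceptional

omit [MetricSpace G] in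
theorem not_countable_range {g : unitInterval → G} (gi : Function.Injective g) :
    ¬ (range g).Countable := fun hc => by
  have h1 : (univ : Set unitInterval).Countable :=
    countable_of_injective_of_countable_image gi.injOn (by rwa [image_univ])
  exact not_countable_Ioo_unitInterval (zero_lt_one) (h1.mono (subset_univ _))

theorem IsMarkovFamily.exists_covers (hh : IsMarkovFamily f h) (i : ι) : ∃ j, Covers f h i j := by
  have hnc : ¬ (f '' range (h i)).Countable := by
    rw [← range_comp]
    exact not_countable_range fun a b e =>
      hh.injective i (hh.injOn i (mem_range_self a) (mem_range_self b) e)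
  obtain ⟨p, hp, hpQ⟩ := not_subset.1 fun hs => hnc (hh.countable_exceptional.mono hs)
  obtain ⟨j, hj⟩ := notMem_exceptional.1 hpQ
  exact ⟨j, hh.markov i j ⟨p, hp, hj⟩⟩

/-- An arc of the partition is covered by only finitely many arcs. -/
theorem IsMarkovFamily.finite_covers [CompactSpace G] (hh : IsMarkovFamily f h) (j : ι) :
    {i | Covers f h i j}.Finite := by
  by_contra hinf
  -- Infinitely many arcs `e n` would contain preimages `p n`, `q n` of the two ends of `j`.
  -- Subsequential limits `a`, `b` are distinct, since `f` sends them to different ends.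
  let e := Set.Infinite.natEmbedding _ hinf
  have he : ∀ n, Covers f h (e n) j := fun n => (e n).2
  choose p hp hfp using fun n => he n (mem_range_self 0)
  choose q hq hfq using fun n => he n (mem_range_self 1)
  obtain ⟨⟨a, b⟩, θ, θm, hθ⟩ := CompactSpace.tendsto_subseq fun n => (p n, q n)
  have ha : Tendsto (fun n => p (θ n)) atTop (𝓝 a) := (continuous_fst.tendsto _).comp hθ
  have hb : Tendsto (fun n => q (θ n)) atTop (𝓝 b) := (continuous_snd.tendsto _).comp hθ
  have hfa : f a = h j 0 := tendsto_nhds_unique ((hh.continuous_map.tendsto a).comp ha)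
    (by simp only [Function.comp_def, hfp]; exact tendsto_const_nhds)
  have hfb : f b = h j 1 := tendsto_nhds_unique ((hh.continuous_map.tendsto b).comp hb)
    (by simp only [Function.comp_def, hfq]; exact tendsto_const_nhds)
  have hab : a ≠ b := by
    rintro rfl
    exact zero_ne_one (hh.injective j (hfa.symm.trans hfb))
  -- The arcs cross every sphere about `a` of radius less than `dist b a`. A limit of crossing
  -- points is exceptional, since an open arc around it would meet infinitely many different arcs of
  -- the family. This gives uncountably many exceptional points.
  have hsub : Ioo 0 (dist b a) ⊆ (fun z => dist z a) '' exceptional h := by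
    rintro r ⟨hr0, hr1⟩
    have h1 : ∀ᶠ n in atTop, dist (p (θ n)) a < r :=
      (ha.dist tendsto_const_nhds).eventually_lt_const (by simpa using hr0)
    have h2 : ∀ᶠ n in atTop, r < dist (q (θ n)) a :=
      (hb.dist tendsto_const_nhds).eventually_const_lt hr1
    have h3 : ∀ᶠ n in atTop, ∃ z ∈ range (h (e (θ n))), dist z a = r := by
      filter_upwards [h1, h2] with n hn1 hn2
      exact (isPreconnected_range (hh.continuous _)).intermediate_value (hp _) (hq _)
        (continuous_id.dist continuous_const).continuousOn (f := fun z => dist z a)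
        ⟨hn1.le, hn2.le⟩
    obtain ⟨N, hN⟩ := eventually_atTop.1 h3
    choose z hz hzr using fun n => hN (N + n) (Nat.le_add_right _ _)
    obtain ⟨c, η, ηm, hη⟩ := CompactSpace.tendsto_subseq z
    refine ⟨c, ?_, ?_⟩
    · by_contra hc
      obtain ⟨k, hk⟩ := notMem_exceptional.1 hc
      have h4 := hη.eventually ((hh.isOpen k).mem_nhds hk)
      obtain ⟨m, hm⟩ := eventually_atTop.1 h4
      have em := hh.eq_of_mem_range (hz _) (hm m le_rfl)
      have em' := hh.eq_of_mem_range (hz _) (hm (m + 1) (Nat.le_succ m))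
      have := e.injective (Subtype.ext (em.trans em'.symm))
      have := θm.injective this
      have := ηm.injective (Nat.add_left_cancel this)
      omega
    · refine tendsto_nhds_unique (hη.dist (tendsto_const_nhds (x := a))) ?_
      simp only [Function.comp_def, hzr]
      exact tendsto_const_nhds
  have h2 := (hh.countable_exceptional.image (fun z => dist z a)).mono hsub
  rw [← Cardinal.le_aleph0_iff_set_countable, Cardinal.mk_Ioo_real
    (dist_pos.2 hab.symm)] at h2
  exact Cardinal.aleph0_lt_continuum.not_ge h2

variable [CompactSpace G] [ConnectedSpace G] [Nonempty ι]

/-- If `f x` were inside the arc `j`, the nonexceptional points near `x` would lie in the arcs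
covering `j`. These are finite in number, so their union is closed and one of them, `i`, contains
`x`. As `f` is injective on `i` and `f(i) ⊇ j`, the point `x` would be interior to `i`. -/
theorem IsMarkovFamily.map_mem_exceptional (hh : IsMarkovFamily f h) {x : G}
    (hx : x ∈ exceptional h) : f x ∈ exceptional h := by
  by_contra hn
  obtain ⟨j, hj⟩ := notMem_exceptional.1 hn
  have hU : IsOpen (f ⁻¹' (h j '' Ioo 0 1)) := (hh.isOpen j).preimage hh.continuous_map
  have h1 := hh.dense_compl_exceptional.open_subset_closure_inter hU hj
  have hcl : IsClosed (⋃ i ∈ {i | Covers f h i j}, range (h i)) :=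
    (hh.finite_covers j).isClosed_biUnion fun i _ =>
      (isCompact_range (hh.continuous i)).isClosed
  have h2 : f ⁻¹' (h j '' Ioo 0 1) ∩ (exceptional h)ᶜ ⊆
      ⋃ i ∈ {i | Covers f h i j}, range (h i) := by
    rintro z ⟨hz1, hz2⟩
    obtain ⟨i, hi⟩ := notMem_exceptional.1 hz2
    have hzi := image_subset_range _ _ hi
    exact mem_biUnion (hh.markov i j ⟨f z, ⟨z, hzi, rfl⟩, hz1⟩) hzi
  have h3 := closure_minimal h2 hcl h1
  simp only [mem_iUnion] at h3
  obtain ⟨i, hi, hxi⟩ := h3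
  have hfi : Function.Injective (f ∘ h i) := fun a b e =>
    hh.injective i (hh.injOn i (mem_range_self a) (mem_range_self b) e)
  have h4 := image_Ioo_subset_of_range_subset (hh.continuous_map.comp (hh.continuous i)) hfi
    (hh.continuous j) (hh.injective j) (by rw [range_comp]; exact hi) hj
  obtain ⟨r, hr, hrx⟩ := h4
  have := hh.injOn i (mem_range_self r) hxi hrx
  exact notMem_exceptional.2 ⟨i, r, hr, this⟩ hx

theorem IsMarkovFamily.iterate_mem_exceptional (hh : IsMarkovFamily f h) {x : G} {k n : ℕ}
    (hkn : k ≤ n) (hx : f^[k] x ∈ exceptional h) : f^[n] x ∈ exceptional h := by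
  induction n, hkn using Nat.le_induction with
  | base => exact hx
  | succ n _ ih => rw [Function.iterate_succ_apply']; exact hh.map_mem_exceptional ih

omit [CompactSpace G] [ConnectedSpace G] [Nonempty ι] in
-- Off the countable exceptional set, the space is a countable union of arcs on each of which `f` is
-- injective.
theorem IsMarkovFamily.countable_preimage [Countable ι] (hh : IsMarkovFamily f h) {C : Set G}
    (hC : C.Countable) (n : ℕ) : (f^[n] ⁻¹' C).Countable := by
  induction n with
  | zero => exact hC
  | succ n ih =>
    have : f^[n + 1] ⁻¹' C ⊆ exceptional h ∪ ⋃ i, range (h i) ∩ f ⁻¹' (f^[n] ⁻¹' C) := by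
      intro z hz
      by_cases hzQ : z ∈ exceptional h
      · exact Or.inl hzQ
      · obtain ⟨i, hi⟩ := notMem_exceptional.1 hzQ
        exact Or.inr (mem_iUnion.2 ⟨i, image_subset_range _ _ hi, hz⟩)
    refine (hh.countable_exceptional.union (countable_iUnion fun i => ?_)).mono this
    refine countable_of_injective_of_countable_image ((hh.injOn i).mono inter_subset_left)
      (ih.mono ?_)
    rintro _ ⟨z, hz, rfl⟩
    exact hz.2

theorem IsMarkovFamily.exists_itinerary (hh : IsMarkovFamily f h) {p : G} {n : ℕ}
    (hp : f^[n] p ∉ exceptional h) : ∃ s : ℕ → ι, p ∈ cylInt f h s n := by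
  have : ∀ k, ∃ i, k ≤ n → f^[k] p ∈ h i '' Ioo 0 1 := fun k => by
    by_cases hk : k ≤ n
    · obtain ⟨i, hi⟩ := notMem_exceptional.1 fun hk' => hp (hh.iterate_mem_exceptional hk hk')
      exact ⟨i, fun _ => hi⟩
    · exact ⟨Classical.arbitrary ι, fun h => (hk h).elim⟩
  choose s hs using this
  exact ⟨s, hs⟩

theorem IsMarkovFamily.mem_cylInt (hh : IsMarkovFamily f h) {p : G} {n : ℕ} {s : ℕ → ι}
    (hps : p ∈ cyl f h s n) (hp : f^[n] p ∉ exceptional h) : p ∈ cylInt f h s n := fun k hk =>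
  hh.mem_image_Ioo (hps k hk) fun hk' => hp (hh.iterate_mem_exceptional hk hk')

omit [MetricSpace G] [CompactSpace G] [ConnectedSpace G] [Nonempty ι] in
theorem cylInt_subset_cyl {s : ℕ → ι} {n : ℕ} : cylInt f h s n ⊆ cyl f h s n :=
  fun _ hp k hk => image_subset_range _ _ (hp k hk)

omit [MetricSpace G] [CompactSpace G] [ConnectedSpace G] [Nonempty ι] in
theorem notMem_exceptional_of_mem_cylInt {p : G} {n : ℕ} {s : ℕ → ι} (hp : p ∈ cylInt f h s n) :
    f^[n] p ∉ exceptional h := notMem_exceptional.2 ⟨_, hp n le_rfl⟩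

omit [CompactSpace G] [ConnectedSpace G] [Nonempty ι] in
theorem IsMarkovFamily.covers_of_mem_cylInt (hh : IsMarkovFamily f h) {p : G} {n : ℕ} {s : ℕ → ι}
    (hp : p ∈ cylInt f h s n) {k : ℕ} (hk : k < n) : Covers f h (s k) (s (k + 1)) := by
  refine hh.markov _ _ ⟨f^[k + 1] p, ?_, hp (k + 1) hk⟩
  rw [Function.iterate_succ_apply']
  exact mem_image_of_mem f (image_subset_range _ _ (hp k hk.le))

theorem IsMarkovFamily.eq_of_mem_cyl (hh : IsMarkovFamily f h) {p : G} {n : ℕ} {s t : ℕ → ι}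
    (hs : p ∈ cyl f h s n) (ht : p ∈ cyl f h t n) (hp : f^[n] p ∉ exceptional h) {k : ℕ}
    (hk : k ≤ n) : s k = t k :=
  hh.eq_of_mem (hh.mem_cylInt hs hp k hk) (hh.mem_cylInt ht hp k hk)

omit [CompactSpace G] [ConnectedSpace G] [Nonempty ι] in
theorem IsMarkovFamily.isOpen_cylInt (hh : IsMarkovFamily f h) (s : ℕ → ι) (n : ℕ) :
    IsOpen (cylInt f h s n) := by
  have : cylInt f h s n = ⋂ k ∈ Iic n, f^[k] ⁻¹' (h (s k) '' Ioo 0 1) := by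
    ext p; simp only [cylInt, mem_ofPred_eq, mem_iInter, mem_preimage, mem_Iic]
  rw [this]
  exact (finite_Iic n).isOpen_biInter fun k _ => (hh.isOpen _).preimage (hh.continuous_map.iterate k)

omit [CompactSpace G] [ConnectedSpace G] [Nonempty ι] in
-- `f^[n]` maps the cylinder homeomorphically onto its last arc, and `g` is the inverse branch. The
-- next branch is found by lifting the arc `s (n + 1)` through `f ∘ h (s n)`, whose image contains
-- it.
theorem IsMarkovFamily.exists_cyl_param (hh : IsMarkovFamily f h) {s : ℕ → ι} {n : ℕ}
    (hs : ∀ k < n, Covers f h (s k) (s (k + 1))) :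
    ∃ g : unitInterval → G, Continuous g ∧ Function.Injective g ∧ range g = cyl f h s n ∧
      ∀ r, f^[n] (g r) = h (s n) r := by
  induction n with
  | zero =>
    refine ⟨h (s 0), hh.continuous _, hh.injective _, ?_, fun r => rfl⟩
    ext p
    simp [cyl]
  | succ n ih =>
    obtain ⟨g, gc, gi, gr, gf⟩ := ih fun k hk => hs k (by omega)
    have hfi : Function.Injective (f ∘ h (s n)) := fun a b e =>
      hh.injective _ (hh.injOn _ (mem_range_self a) (mem_range_self b) e)
    obtain ⟨θ, θc, hθ⟩ := exists_continuous_lift (hh.continuous_map.comp (hh.continuous (s n))) hfi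
      (hh.continuous (s (n + 1))) (by rw [range_comp]; exact hs n n.lt_succ_self)
    have hg : ∀ r, f^[n + 1] (g (θ r)) = h (s (n + 1)) r := fun r => by
      rw [Function.iterate_succ_apply', gf]; exact hθ r
    refine ⟨g ∘ θ, gc.comp θc, fun a b e => hh.injective (s (n + 1)) ?_, ?_, hg⟩
    · rw [← hg, ← hg]; exact congrArg _ e
    · rw [cyl_succ, ← gr]
      ext p
      constructor
      · rintro ⟨r, rfl⟩
        exact ⟨mem_range_self _, r, (hg r).symm⟩
      · rintro ⟨⟨a, rfl⟩, r, hr⟩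
        refine ⟨r, ?_⟩
        rw [Function.iterate_succ_apply', gf, ← hθ r] at hr
        exact congrArg g (hfi hr)

theorem IsMarkovFamily.image_Ioo_eq_cylInt (hh : IsMarkovFamily f h) {s : ℕ → ι} {n : ℕ}
    {g : unitInterval → G} (gr : range g = cyl f h s n) (gf : ∀ r, f^[n] (g r) = h (s n) r) :
    g '' Ioo 0 1 = cylInt f h s n := by
  ext p
  constructor
  · rintro ⟨r, hr, rfl⟩
    exact hh.mem_cylInt (gr ▸ mem_range_self r) (notMem_exceptional.2 ⟨s n, r, hr, (gf r).symm⟩)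
  · intro hp
    obtain ⟨r, rfl⟩ := gr ▸ cylInt_subset_cyl hp
    obtain ⟨r', hr', e⟩ := hp n le_rfl
    rw [gf] at e
    exact ⟨r, hh.injective _ e ▸ hr', rfl⟩

end

/-! ### Consequences of mixing: branching, small cylinders, itineraries of a point -/

section

variable {G : Type u} {ι : Type u} [MetricSpace G] {f : G → G} {h : ι → unitInterval → G}
  [CompactSpace G] [ConnectedSpace G] [Nonempty ι]

omit [MetricSpace G] [CompactSpace G] [ConnectedSpace G] in
/-- A homeomorphism of an arc is not topologically mixing. -/
theorem not_isTopMixing_of_arc [TopologicalSpace G] [T2Space G] (hf : Continuous f)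
    (fi : Function.Injective f) {g : unitInterval → G} (gc : Continuous g)
    (gi : Function.Injective g) (gs : Function.Surjective g) : ¬ IsTopMixing f := by
  intro hmix
  obtain ⟨ψ, ψc, hψ⟩ := exists_continuous_lift gc gi (hf.comp gc) (by
    rw [gs.range_eq]; exact subset_univ _)
  have ψi : Function.Injective ψ := fun a b e =>
    gi (fi (by rw [← Function.comp_apply (f := f), ← hψ, e, hψ]; rfl))
  have hm : StrictMono (ψ ∘ ψ) := by
    rcases ψc.strictMono_of_inj_boundedOrder' ψi with h | h
    exacts [h.comp h, h.comp h]
  have hiter : ∀ N r, g ((ψ ∘ ψ)^[N] r) = f^[2 * N] (g r) := fun N => by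
    induction N with
    | zero => intro r; rfl
    | succ N ih =>
      intro r
      rw [Function.iterate_succ_apply, ih, show 2 * (N + 1) = 2 * N + 1 + 1 from rfl,
        Function.iterate_succ_apply, Function.iterate_succ_apply]
      simp only [Function.comp_apply, hψ]
  obtain ⟨c, hc0, hc1⟩ := exists_between (zero_lt_one (α := unitInterval))
  have hop : ∀ S : Set unitInterval, IsOpen S → IsOpen (g '' S) := fun S hS => by
    rw [← compl_compl S, image_compl_eq ⟨gi, gs⟩]
    exact (hS.isClosed_compl.isCompact.image gc).isClosed.isOpen_compl
  have key : ∀ S T : Set unitInterval, IsOpen S → IsOpen T → S.Nonempty → T.Nonempty →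
      Disjoint S T → (∀ r ∈ S, (ψ ∘ ψ) r ∈ S) → False := by
    intro S T hS hT hSn hTn hd hinv
    obtain ⟨N, hN⟩ := hmix _ _ (hop S hS) (hop T hT) (hSn.image g) (hTn.image g)
    obtain ⟨_, ⟨_, ⟨r, hr, rfl⟩, rfl⟩, r', hr', e⟩ := hN (2 * N) (by omega)
    rw [← hiter] at e
    have : (ψ ∘ ψ)^[N] r ∈ S := by
      clear hN e
      induction N with
      | zero => exact hr
      | succ N ih => rw [Function.iterate_succ_apply']; exact hinv _ ih
    exact disjoint_left.1 hd this (gi e ▸ hr')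
  have hd : Disjoint (Ioi c) (Iio c) := disjoint_left.2 fun r h1 h2 =>
    lt_asymm (mem_Ioi.1 h1) (mem_Iio.1 h2)
  -- The second iterate is increasing, so one of the two sides of `c` is invariant under it and
  -- never reaches the other side at even times.
  rcases le_total c ((ψ ∘ ψ) c) with hle | hle
  · exact key (Ioi c) (Iio c) isOpen_Ioi isOpen_Iio ⟨1, hc1⟩ ⟨0, hc0⟩ hd
      fun r hr => hle.trans_lt (hm hr)
  · exact key (Iio c) (Ioi c) isOpen_Iio isOpen_Ioi ⟨0, hc0⟩ ⟨1, hc1⟩ hd.symm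
      fun r hr => (hm hr).trans_le hle

omit [CompactSpace G] in
-- A single arc would be dense and closed, hence all of `G`, and `f` would be an injective self-map
-- of an arc.
theorem IsMarkovFamily.nontrivial_index (hh : IsMarkovFamily f h) : Nontrivial ι := by
  by_contra hn
  rw [not_nontrivial_iff_subsingleton] at hn
  let i : ι := Classical.arbitrary ι
  have hsurj : Function.Surjective (h i) := by
    intro p
    by_contra hp
    have ho : IsOpen (range (h i))ᶜ := (isCompact_range (hh.continuous i)).isClosed.isOpen_compl
    obtain ⟨q, hq, hqQ⟩ := hh.dense_compl_exceptional.inter_open_nonempty _ ho ⟨p, hp⟩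
    obtain ⟨j, hj⟩ := notMem_exceptional.1 hqQ
    rw [Subsingleton.elim j i] at hj
    exact hq (image_subset_range _ _ hj)
  exact not_isTopMixing_of_arc hh.continuous_map
    (injOn_univ.1 (hsurj.range_eq ▸ hh.injOn i)) (hh.continuous i) (hh.injective i) hsurj hh.mixing

/-- Mixing: any two arcs are joined by paths of every sufficiently large length. -/
theorem IsMarkovFamily.exists_path (hh : IsMarkovFamily f h) (i j : ι) :
    ∃ N, ∀ n ≥ N, ∃ s : ℕ → ι, s 0 = i ∧ s n = j ∧ ∀ k < n, Covers f h (s k) (s (k + 1)) := by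
  obtain ⟨N, hN⟩ := hh.mixing _ _ (hh.isOpen i) (hh.isOpen j) image_Ioo_nonempty image_Ioo_nonempty
  refine ⟨N, fun n hn => ?_⟩
  obtain ⟨_, ⟨p, hp, rfl⟩, hpj⟩ := hN n hn
  obtain ⟨s, hs⟩ := hh.exists_itinerary (notMem_exceptional.2 ⟨j, hpj⟩)
  exact ⟨s, hh.eq_of_mem (hs 0 (Nat.zero_le n)) hp, hh.eq_of_mem (hs n le_rfl) hpj,
    fun k hk => hh.covers_of_mem_cylInt hs hk⟩

/-- There are no infinite paths without branching. -/
theorem IsMarkovFamily.exists_branching (hh : IsMarkovFamily f h) (t : ℕ → ι) :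
    ∃ k j, Covers f h (t k) j ∧ j ≠ t (k + 1) := by
  by_contra! hn
  have := hh.nontrivial_index
  obtain ⟨j, j', hne⟩ := exists_pair_ne ι
  obtain ⟨N, hN⟩ := hh.exists_path (t 0) j
  obtain ⟨N', hN'⟩ := hh.exists_path (t 0) j'
  -- Without branching all paths from `t 0` agree, yet at a large common time one must be at `j` and
  -- another at `j'`.
  have key : ∀ (n : ℕ) (s : ℕ → ι), s 0 = t 0 → (∀ k < n, Covers f h (s k) (s (k + 1))) →
      ∀ k ≤ n, s k = t k := by
    intro n s h0 hs k hk
    induction k with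
    | zero => exact h0
    | succ k ih => exact hn k _ (ih (by omega) ▸ hs k hk)
  obtain ⟨s, h0, hj, hs⟩ := hN (max N N') (le_max_left _ _)
  obtain ⟨s', h0', hj', hs'⟩ := hN' (max N N') (le_max_right _ _)
  exact hne (by rw [← hj, ← hj', key _ s h0 hs _ le_rfl, key _ s' h0' hs' _ le_rfl])

omit [CompactSpace G] in
-- Otherwise every iterate of the open subarc, being connected, would stay inside one open partition
-- arc, whereas mixing makes a late iterate meet two.
theorem IsMarkovFamily.exists_mem_Ioo_iterate (hh : IsMarkovFamily f h) (i : ι)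
    {a b : unitInterval} (hab : a < b) :
    ∃ r ∈ Ioo a b, ∃ n, f^[n] (h i r) ∈ exceptional h := by
  by_contra! hn
  have hne : (h i '' Ioo a b).Nonempty := (nonempty_Ioo.2 hab).image _
  have ho : IsOpen (h i '' Ioo a b) := isOpen_image_of_subset_Ioo (hh.continuous i)
    (hh.injective i) (hh.isOpen i) isOpen_Ioo (Ioo_subset_Ioo unitInterval.nonneg'
      unitInterval.le_one')
  have := hh.nontrivial_index
  obtain ⟨j, j', hjj⟩ := exists_pair_ne ι
  obtain ⟨N, hN⟩ := hh.mixing _ _ ho (hh.isOpen j) hne image_Ioo_nonempty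
  obtain ⟨N', hN'⟩ := hh.mixing _ _ ho (hh.isOpen j') hne image_Ioo_nonempty
  obtain ⟨p, hp, hpj⟩ := hN (max N N') (le_max_left _ _)
  obtain ⟨q, hq, hqj⟩ := hN' (max N N') (le_max_right _ _)
  have hpre : IsPreconnected (f^[max N N'] '' (h i '' Ioo a b)) :=
    (isPreconnected_Ioo.image _ (hh.continuous i).continuousOn).image _
      (hh.continuous_map.iterate _).continuousOn
  have hsub : f^[max N N'] '' (h i '' Ioo a b) ⊆
      h j '' Ioo 0 1 ∪ ⋃ k ∈ {k | k ≠ j}, h k '' Ioo 0 1 := by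
    rintro _ ⟨_, ⟨r, hr, rfl⟩, rfl⟩
    obtain ⟨k, hk⟩ := notMem_exceptional.1 (hn r hr (max N N'))
    by_cases hkj : k = j
    · exact Or.inl (hkj ▸ hk)
    · exact Or.inr (mem_biUnion hkj hk)
  obtain ⟨z, -, hz1, hz2⟩ := hpre _ _ (hh.isOpen j) (isOpen_biUnion fun k _ => hh.isOpen k) hsub
    ⟨p, hp, hpj⟩ ⟨q, hq, mem_biUnion hjj.symm hqj⟩
  obtain ⟨k, hk, hzk⟩ := mem_iUnion₂.1 hz2
  exact hk (hh.eq_of_mem hzk hz1)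

omit [CompactSpace G] [ConnectedSpace G] [Nonempty ι] in
theorem IsMarkovFamily.exists_mem_notMem_exceptional [Countable ι] (hh : IsMarkovFamily f h)
    (i : ι) {a b : unitInterval} (hab : a < b) (n : ℕ) :
    ∃ r ∈ Ioo a b, f^[n] (h i r) ∉ exceptional h := by
  by_contra! hn
  exact not_countable_Ioo_unitInterval hab
    (((hh.countable_preimage hh.countable_exceptional n).preimage (hh.injective i)).mono hn)

/-- Every nonempty open set contains a cylinder. -/
theorem IsMarkovFamily.exists_cyl_subset [Countable ι] (hh : IsMarkovFamily f h) {U : Set G}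
    (hU : IsOpen U) (hne : U.Nonempty) : ∃ (s : ℕ → ι) (n : ℕ),
      (∀ k < n, Covers f h (s k) (s (k + 1))) ∧ cyl f h s n ⊆ U := by
  obtain ⟨p, hpU, hpQ⟩ := hh.dense_compl_exceptional.inter_open_nonempty U hU hne
  obtain ⟨i, τ, hτ, rfl⟩ := notMem_exceptional.1 hpQ
  obtain ⟨a, b, ⟨ha, hb⟩, hab⟩ := (mem_nhds_iff_exists_Ioo_subset' ⟨0, hτ.1⟩ ⟨1, hτ.2⟩).1
    (((hU.preimage (hh.continuous i)).inter isOpen_Ioo).mem_nhds ⟨hpU, hτ⟩)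
  obtain ⟨r₁, hr₁, n₁, e₁⟩ := hh.exists_mem_Ioo_iterate i ha
  obtain ⟨r₂, hr₂, n₂, e₂⟩ := hh.exists_mem_Ioo_iterate i hb
  have hr : r₁ < r₂ := hr₁.2.trans hr₂.1
  let n := max n₁ n₂
  have e₁' : f^[n] (h i r₁) ∈ exceptional h := hh.iterate_mem_exceptional (le_max_left _ _) e₁
  have e₂' : f^[n] (h i r₂) ∈ exceptional h := hh.iterate_mem_exceptional (le_max_right _ _) e₂
  obtain ⟨r, ⟨hr1, hr2⟩, hrQ⟩ := hh.exists_mem_notMem_exceptional i hr n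
  obtain ⟨s, hs⟩ := hh.exists_itinerary hrQ
  have hcov : ∀ k < n, Covers f h (s k) (s (k + 1)) := fun k hk => hh.covers_of_mem_cylInt hs hk
  refine ⟨s, n, hcov, ?_⟩
  obtain ⟨g, gc, gi, gr, gf⟩ := hh.exists_cyl_param hcov
  have hI := hh.image_Ioo_eq_cylInt gr gf
  have hs0 : s 0 = i := hh.eq_of_mem (hs 0 (Nat.zero_le _)) ⟨r, (hab ⟨hr₁.1.trans hr1,
    hr2.trans hr₂.2⟩).2, rfl⟩
  obtain ⟨ψ, ψc, hψ⟩ := exists_continuous_lift (hh.continuous i) (hh.injective i) gc (by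
    rw [gr, ← hs0]; exact fun z hz => hz 0 (Nat.zero_le _))
  obtain ⟨ρ, hρ, e⟩ := hI.symm ▸ hs
  have hψρ : ψ ρ = r := hh.injective i (by rw [hψ, e])
  have hord : OrdConnected (ψ '' Ioo 0 1) :=
    (isPreconnected_Ioo.image ψ ψc.continuousOn).ordConnected
  have hav : ∀ r', f^[n] (h i r') ∈ exceptional h → r' ∉ ψ '' Ioo 0 1 := by
    rintro _ hr' ⟨σ, hσ, rfl⟩
    rw [hψ, gf] at hr'
    exact notMem_exceptional.2 ⟨_, σ, hσ, rfl⟩ hr'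
  have hin : g '' Ioo 0 1 ⊆ h i '' Icc r₁ r₂ := by
    rintro _ ⟨σ, hσ, rfl⟩
    refine ⟨ψ σ, ⟨?_, ?_⟩, hψ σ⟩
    · by_contra! hlt
      exact hav r₁ e₁' (hord.out ⟨σ, hσ, rfl⟩ ⟨ρ, hρ, rfl⟩ ⟨hlt.le, hψρ ▸ hr1.le⟩)
    · by_contra! hlt
      exact hav r₂ e₂' (hord.out ⟨ρ, hρ, rfl⟩ ⟨σ, hσ, rfl⟩ ⟨hψρ ▸ hr2.le, hlt.le⟩)
  rw [← gr, ← closure_image_Ioo gc]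
  refine (closure_minimal hin (isClosed_Icc.isCompact.image (hh.continuous i)).isClosed).trans ?_
  rintro _ ⟨σ, hσ, rfl⟩
  exact (hab ⟨hr₁.1.trans_le hσ.1, hσ.2.trans_lt hr₂.2⟩).1

theorem IsMarkovFamily.subsingleton_of_Icc_subset [Countable ι] (hh : IsMarkovFamily f h) {i : ι}
    {S : Set (ℕ → ι)} (hS : ∀ s ∈ S, ∀ t ∈ S, ∀ n, ∃ a b, a < b ∧
      h i '' Icc a b ⊆ cyl f h s n ∩ cyl f h t n) : S.Subsingleton := by
  intro s hs t ht
  funext n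
  obtain ⟨a, b, hab, hsub⟩ := hS s hs t ht n
  obtain ⟨r, hr, hrQ⟩ := hh.exists_mem_notMem_exceptional i hab n
  have := hsub ⟨r, Ioo_subset_Icc_self hr, rfl⟩
  exact hh.eq_of_mem_cyl this.1 this.2 hrQ le_rfl

/-- A point has countably many itineraries. -/
theorem IsMarkovFamily.countable_itineraries [Countable ι] (hh : IsMarkovFamily f h) (x : G) :
    {s : ℕ → ι | (∀ k, Covers f h (s k) (s (k + 1))) ∧ ∀ n, x ∈ cyl f h s n}.Countable := by
  -- `L i τ`, resp. `R i τ`, collects the itineraries all of whose cylinders contain a left, resp.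
  -- right, neighbourhood of `τ` in the arc `i`. Two itineraries of the same kind share a
  -- nondegenerate subarc at every level, hence coincide.
  let L : ι → unitInterval → Set (ℕ → ι) := fun i τ =>
    {s | ∀ n, ∃ a < τ, h i '' Icc a τ ⊆ cyl f h s n}
  let R : ι → unitInterval → Set (ℕ → ι) := fun i τ =>
    {s | ∀ n, ∃ b > τ, h i '' Icc τ b ⊆ cyl f h s n}
  have hL : ∀ i τ, (L i τ).Subsingleton := fun i τ => hh.subsingleton_of_Icc_subset (i := i)
    fun s hs t ht n => by
      obtain ⟨a, ha, hsa⟩ := hs n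
      obtain ⟨b, hb, hsb⟩ := ht n
      exact ⟨max a b, τ, max_lt ha hb, subset_inter
        ((image_mono (Icc_subset_Icc_left (le_max_left _ _))).trans hsa)
        ((image_mono (Icc_subset_Icc_left (le_max_right _ _))).trans hsb)⟩
  have hR : ∀ i τ, (R i τ).Subsingleton := fun i τ => hh.subsingleton_of_Icc_subset (i := i)
    fun s hs t ht n => by
      obtain ⟨a, ha, hsa⟩ := hs n
      obtain ⟨b, hb, hsb⟩ := ht n
      exact ⟨τ, min a b, lt_min ha hb, subset_inter
        ((image_mono (Icc_subset_Icc_right (min_le_left _ _))).trans hsa)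
        ((image_mono (Icc_subset_Icc_right (min_le_right _ _))).trans hsb)⟩
  have hτ : ∀ i, ∃ τ, x ∈ range (h i) → h i τ = x := fun i => by
    by_cases hx : x ∈ range (h i)
    · exact hx.imp fun τ e _ => e
    · exact ⟨0, fun h => (hx h).elim⟩
  choose τ hτ using hτ
  refine (countable_iUnion fun i => ((hL i (τ i)).countable.union (hR i (τ i)).countable)).mono ?_
  rintro s ⟨hcov, hx⟩
  refine mem_iUnion.2 ⟨s 0, ?_⟩
  have hx0 : h (s 0) (τ (s 0)) = x := hτ _ (hx 0 0 le_rfl)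
  -- A cylinder through `x` is a nondegenerate subarc, so it extends to at least one side of `x`. As
  -- cylinders are nested, one side serves all levels.
  have hone : ∀ n, (∃ a < τ (s 0), h (s 0) '' Icc a (τ (s 0)) ⊆ cyl f h s n) ∨
      ∃ b > τ (s 0), h (s 0) '' Icc (τ (s 0)) b ⊆ cyl f h s n := by
    intro n
    obtain ⟨g, gc, gi, gr, -⟩ := hh.exists_cyl_param (n := n) fun k _ => hcov k
    obtain ⟨ψ, ψc, hψ⟩ := exists_continuous_lift (hh.continuous (s 0)) (hh.injective (s 0)) gc (by
      rw [gr]; exact fun z hz => hz 0 (Nat.zero_le _))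
    have hord : OrdConnected (range ψ) := (isPreconnected_range ψc).ordConnected
    have hsub : ∀ T ⊆ range ψ, h (s 0) '' T ⊆ cyl f h s n := by
      rintro T hT _ ⟨σ, hσ, rfl⟩
      obtain ⟨ρ, rfl⟩ := hT hσ
      rw [hψ, ← gr]
      exact mem_range_self ρ
    obtain ⟨ρ, hρ⟩ : ∃ ρ, ψ ρ = τ (s 0) := by
      obtain ⟨ρ, e⟩ := gr.symm ▸ hx n
      exact ⟨ρ, hh.injective _ (by rw [hψ, e, hx0])⟩
    obtain ⟨ρ', hρ'⟩ := exists_ne ρ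
    have hne : ψ ρ' ≠ τ (s 0) := fun e => hρ' (gi (by rw [← hψ, ← hψ, e, hρ]))
    rcases lt_or_gt_of_ne hne with hlt | hlt
    · exact Or.inl ⟨ψ ρ', hlt, hsub _ (hord.out ⟨ρ', rfl⟩ ⟨ρ, hρ⟩)⟩
    · exact Or.inr ⟨ψ ρ', hlt, hsub _ (hord.out ⟨ρ, hρ⟩ ⟨ρ', rfl⟩)⟩
  by_contra hn
  rw [mem_union, not_or] at hn
  obtain ⟨h1, h2⟩ := hn
  simp only [L, R, mem_ofPred_eq, not_forall] at h1 h2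
  obtain ⟨n₁, h1⟩ := h1
  obtain ⟨n₂, h2⟩ := h2
  rcases hone (max n₁ n₂) with ⟨a, ha, hsa⟩ | ⟨b, hb, hsb⟩
  · exact h1 ⟨a, ha, hsa.trans (cyl_antitone f h s (le_max_left _ _))⟩
  · exact h2 ⟨b, hb, hsb.trans (cyl_antitone f h s (le_max_right _ _))⟩

end

/-! ### Weights along paths -/

section

variable {G : Type u} {ι : Type u}

open Classical in
/-- The transition matrix of a parametrized partition. -/
noncomputable def coverMatrix (f : G → G) (h : ι → unitInterval → G) (i j : ι) : ℝ :=
  if Covers f h i j then 1 else 0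

/-- The expansion rate of the vector `v` at the arc `i`. -/
noncomputable def coverRate (f : G → G) (h : ι → unitInterval → G) (v : ι → ℝ) (i : ι) : ℝ :=
  (∑' j, coverMatrix f h i j * v j) / v i

/-- The weight of the first `n + 1` letters of a path. -/
noncomputable def pathWeight (f : G → G) (h : ι → unitInterval → G) (v : ι → ℝ) (s : ℕ → ι)
    (n : ℕ) : ℝ :=
  v (s n) / ∏ k ∈ Finset.range n, coverRate f h v (s k)

/-- A subeigenvector of the transition matrix with total mass one and finite deficiency. -/
structure IsSubeigen (f : G → G) (h : ι → unitInterval → G) (lam : ℝ) (v : ι → ℝ) : Prop where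
  one_lt : 1 < lam
  nonneg : ∀ i, 0 ≤ v i
  hasSum : HasSum v 1
  summable : ∀ i, Summable fun j => coverMatrix f h i j * v j
  le : ∀ i, ∑' j, coverMatrix f h i j * v j ≤ lam * v i
  finite : {i | coverRate f h v i < lam}.Finite

theorem coverMatrix_of_covers {f : G → G} {h : ι → unitInterval → G} {i j : ι}
    (hij : Covers f h i j) : coverMatrix f h i j = 1 := if_pos hij

theorem coverMatrix_of_not_covers {f : G → G} {h : ι → unitInterval → G} {i j : ι}
    (hij : ¬ Covers f h i j) : coverMatrix f h i j = 0 := if_neg hij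

theorem coverMatrix_nonneg (f : G → G) (h : ι → unitInterval → G) (i j : ι) :
    0 ≤ coverMatrix f h i j := by
  unfold coverMatrix; split_ifs <;> norm_num

variable [MetricSpace G] {f : G → G} {h : ι → unitInterval → G} [CompactSpace G] [ConnectedSpace G]
  {lam : ℝ} {v : ι → ℝ}

omit [MetricSpace G] [CompactSpace G] [ConnectedSpace G] in
theorem IsSubeigen.le_tsum_of_covers (hv : IsSubeigen f h lam v) {i j : ι} (hij : Covers f h i j) :
    v j ≤ ∑' j, coverMatrix f h i j * v j := by
  have := (hv.summable i).le_tsum j fun k _ => mul_nonneg (coverMatrix_nonneg f h i k) (hv.nonneg k)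
  rwa [coverMatrix_of_covers hij, one_mul] at this

omit [MetricSpace G] [CompactSpace G] [ConnectedSpace G] in
theorem IsSubeigen.nonempty (hv : IsSubeigen f h lam v) : Nonempty ι := by
  by_contra hn
  rw [not_nonempty_iff] at hn
  exact zero_ne_one (hasSum_empty.unique hv.hasSum)

/-- Positivity propagates backwards along paths, since `v j ≤ lam * v i` when `i` covers `j`, and
every arc has a path to an arc of positive mass. -/
theorem IsSubeigen.pos (hv : IsSubeigen f h lam v) (hh : IsMarkovFamily f h) (i : ι) : 0 < v i := by
  have := hv.nonempty
  obtain ⟨j, hj⟩ : ∃ j, 0 < v j := by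
    by_contra! hn
    have : v = 0 := funext fun j => le_antisymm (hn j) (hv.nonneg j)
    exact zero_ne_one (hasSum_zero.unique (this ▸ hv.hasSum))
  obtain ⟨N, hN⟩ := hh.exists_path i j
  obtain ⟨s, h0, hs, hcov⟩ := hN N le_rfl
  have : ∀ k ≤ N, 0 < v (s (N - k)) := by
    intro k hk
    induction k with
    | zero => simpa [hs] using hj
    | succ k ih =>
      have h1 := hcov (N - (k + 1)) (by omega)
      rw [show N - (k + 1) + 1 = N - k by omega] at h1
      have h2 := (ih (by omega)).trans_le ((hv.le_tsum_of_covers h1).trans (hv.le _))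
      exact pos_of_mul_pos_right h2 (zero_lt_one.trans hv.one_lt).le
  simpa [h0] using this N le_rfl

theorem IsSubeigen.rate_mul (hv : IsSubeigen f h lam v) (hh : IsMarkovFamily f h) (i : ι) :
    coverRate f h v i * v i = ∑' j, coverMatrix f h i j * v j :=
  div_mul_cancel₀ _ (hv.pos hh i).ne'

theorem IsSubeigen.rate_pos (hv : IsSubeigen f h lam v) (hh : IsMarkovFamily f h) (i : ι) :
    0 < coverRate f h v i := by
  obtain ⟨j, hj⟩ := hh.exists_covers i
  exact div_pos ((hv.pos hh j).trans_le (hv.le_tsum_of_covers hj)) (hv.pos hh i)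

theorem IsSubeigen.rate_le (hv : IsSubeigen f h lam v) (hh : IsMarkovFamily f h) (i : ι) :
    coverRate f h v i ≤ lam :=
  (div_le_iff₀ (hv.pos hh i)).2 (hv.le i)

omit [MetricSpace G] [CompactSpace G] [ConnectedSpace G] in
theorem IsSubeigen.le_one (hv : IsSubeigen f h lam v) (i : ι) : v i ≤ 1 :=
  le_hasSum hv.hasSum i fun j _ => hv.nonneg j

theorem IsSubeigen.pathWeight_pos (hv : IsSubeigen f h lam v) (hh : IsMarkovFamily f h)
    (s : ℕ → ι) (n : ℕ) : 0 < pathWeight f h v s n :=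
  div_pos (hv.pos hh _) (Finset.prod_pos fun _ _ => hv.rate_pos hh _)

/-- The transition probabilities of the associated Markov chain. -/
noncomputable def coverProb (f : G → G) (h : ι → unitInterval → G) (v : ι → ℝ) (i j : ι) : ℝ :=
  coverMatrix f h i j * v j / (coverRate f h v i * v i)

theorem IsSubeigen.coverProb_nonneg (hv : IsSubeigen f h lam v) (hh : IsMarkovFamily f h)
    (i j : ι) : 0 ≤ coverProb f h v i j :=
  div_nonneg (mul_nonneg (coverMatrix_nonneg f h i j) (hv.nonneg j))
    (mul_pos (hv.rate_pos hh i) (hv.pos hh i)).le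

theorem IsSubeigen.coverProb_pos (hv : IsSubeigen f h lam v) (hh : IsMarkovFamily f h)
    {i j : ι} (hij : Covers f h i j) : 0 < coverProb f h v i j := by
  rw [coverProb, coverMatrix_of_covers hij, one_mul]
  exact div_pos (hv.pos hh j) (mul_pos (hv.rate_pos hh i) (hv.pos hh i))

theorem IsSubeigen.hasSum_coverProb (hv : IsSubeigen f h lam v) (hh : IsMarkovFamily f h) (i : ι) :
    HasSum (coverProb f h v i) 1 := by
  have := (hv.summable i).hasSum.div_const (coverRate f h v i * v i)
  rwa [← hv.rate_mul hh i, div_self (mul_pos (hv.rate_pos hh i) (hv.pos hh i)).ne'] at this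

theorem IsSubeigen.coverProb_le_one (hv : IsSubeigen f h lam v) (hh : IsMarkovFamily f h)
    (i j : ι) : coverProb f h v i j ≤ 1 :=
  le_hasSum (hv.hasSum_coverProb hh i) j fun k _ => hv.coverProb_nonneg hh i k

theorem IsSubeigen.pathWeight_succ (hv : IsSubeigen f h lam v) (hh : IsMarkovFamily f h)
    {s : ℕ → ι} {n : ℕ} (hs : Covers f h (s n) (s (n + 1))) :
    pathWeight f h v s (n + 1) = pathWeight f h v s n * coverProb f h v (s n) (s (n + 1)) := by
  rw [pathWeight, pathWeight, coverProb, coverMatrix_of_covers hs, Finset.prod_range_succ, one_mul]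
  have h1 := (hv.pos hh (s n)).ne'
  have h2 := (hv.rate_pos hh (s n)).ne'
  have h3 : ∏ k ∈ Finset.range n, coverRate f h v (s k) ≠ 0 :=
    (Finset.prod_pos fun _ _ => hv.rate_pos hh _).ne'
  field_simp

/-- The entries of `v` telescope, so the weights are exactly the word probabilities of the Markov
chain. -/
theorem IsSubeigen.prod_coverProb (hv : IsSubeigen f h lam v) (hh : IsMarkovFamily f h)
    {s : ℕ → ι} {n : ℕ} (hs : ∀ k < n, Covers f h (s k) (s (k + 1))) :
    v (s 0) * ∏ k ∈ Finset.range n, coverProb f h v (s k) (s (k + 1)) = pathWeight f h v s n := by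
  induction n with
  | zero => simp [pathWeight]
  | succ n ih =>
    rw [Finset.prod_range_succ, ← mul_assoc, ih fun k hk => hs k (by omega),
      hv.pathWeight_succ hh (hs n n.lt_succ_self)]

/-- The transition probabilities at a branching arc are bounded away from one. -/
theorem IsSubeigen.exists_coverProb_le (hv : IsSubeigen f h lam v) (hh : IsMarkovFamily f h)
    {i j j' : ι} (hj : Covers f h i j) (hj' : Covers f h i j') (hne : j ≠ j') :
    ∃ c < 1, ∀ k, coverProb f h v i k ≤ c := by
  have h1 : ∀ k l, k ≠ l → coverProb f h v i k ≤ 1 - coverProb f h v i l := by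
    intro k l hkl
    classical
    have := sum_le_hasSum {k, l} (fun m _ => hv.coverProb_nonneg hh i m) (hv.hasSum_coverProb hh i)
    rw [Finset.sum_pair hkl] at this
    linarith
  refine ⟨max (1 - coverProb f h v i j) (1 - coverProb f h v i j'), max_lt ?_ ?_, fun k => ?_⟩
  · linarith [hv.coverProb_pos hh hj]
  · linarith [hv.coverProb_pos hh hj']
  · by_cases hk : k = j
    · exact (h1 k j' (hk ▸ hne)).trans (le_max_right _ _)
    · exact (h1 k j hk).trans (le_max_left _ _)

theorem IsSubeigen.antitone_pathWeight (hv : IsSubeigen f h lam v) (hh : IsMarkovFamily f h)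
    {s : ℕ → ι} (hs : ∀ k, Covers f h (s k) (s (k + 1))) : Antitone (pathWeight f h v s) :=
  antitone_nat_of_succ_le fun n => by
    rw [hv.pathWeight_succ hh (hs n)]
    exact mul_le_of_le_one_right (hv.pathWeight_pos hh s n).le (hv.coverProb_le_one hh _ _)

/-- A path through some arc infinitely often passes infinitely often through a branching arc. -/
theorem IsMarkovFamily.exists_branching_frequently [Nonempty ι] (hh : IsMarkovFamily f h)
    {s : ℕ → ι} (hs : ∀ k, Covers f h (s k) (s (k + 1))) {i : ι}
    (hi : ∃ᶠ n in atTop, s n = i) :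
    ∃ b j j', Covers f h b j ∧ Covers f h b j' ∧ j ≠ j' ∧ ∃ᶠ n in atTop, s n = b := by
  choose nxt hnxt using hh.exists_covers
  -- Any path is forced to follow `t` from `i` up to the first branching time `K`, so each visit to
  -- `i` brings a visit to `t K` exactly `K` steps later.
  let t : ℕ → ι := fun k => nxt^[k] i
  have ht : ∀ k, Covers f h (t k) (t (k + 1)) := fun k => by
    simp only [t, Function.iterate_succ_apply']; exact hnxt _
  have hbr := hh.exists_branching t
  classical
  let K := Nat.find hbr
  obtain ⟨j, hj, hjne⟩ := Nat.find_spec hbr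
  have hforce : ∀ k < K, ∀ j, Covers f h (t k) j → j = t (k + 1) := fun k hk j hj => by
    by_contra hne
    exact Nat.find_min hbr hk ⟨j, hj, hne⟩
  refine ⟨t K, j, t (K + 1), hj, ht K, hjne, ?_⟩
  rw [frequently_atTop] at hi ⊢
  intro N
  obtain ⟨n, hn, hni⟩ := hi N
  refine ⟨n + K, by omega, ?_⟩
  have : ∀ k ≤ K, s (n + k) = t k := by
    intro k hk
    induction k with
    | zero => exact hni
    | succ k ih => exact hforce k (by omega) _ (ih (by omega) ▸ hs (n + k))
  exact this K le_rfl

theorem IsSubeigen.tendsto_pathWeight (hv : IsSubeigen f h lam v) (hh : IsMarkovFamily f h)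
    {s : ℕ → ι} (hs : ∀ k, Covers f h (s k) (s (k + 1))) :
    Tendsto (pathWeight f h v s) atTop (𝓝 0) := by
  have := hv.nonempty
  by_cases hrec : ∃ i, ∃ᶠ n in atTop, s n = i
  · obtain ⟨i, hi⟩ := hrec
    obtain ⟨b, j, j', hj, hj', hne, hb⟩ := hh.exists_branching_frequently hs hi
    obtain ⟨c, hc, hle⟩ := hv.exists_coverProb_le hh hj hj' hne
    have hanti := hv.antitone_pathWeight hh hs
    have hbdd : BddBelow (range (pathWeight f h v s)) :=
      ⟨0, by rintro _ ⟨n, rfl⟩; exact (hv.pathWeight_pos hh s n).le⟩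
    obtain ⟨L, hL⟩ : ∃ L, Tendsto (pathWeight f h v s) atTop (𝓝 L) :=
      ⟨_, tendsto_atTop_ciInf hanti hbdd⟩
    have hL0 : 0 ≤ L := ge_of_tendsto' hL fun n => (hv.pathWeight_pos hh s n).le
    -- Each visit to the branching arc `b` is followed by a factor at most `c`, and there are
    -- infinitely many visits.
    have hLc : L ≤ L * c := by
      by_contra! hlt
      have h1 : ∀ᶠ n in atTop, pathWeight f h v s n * c < pathWeight f h v s (n + 1) :=
        (hL.mul_const c).eventually_lt ((tendsto_add_atTop_iff_nat 1).2 hL) hlt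
      obtain ⟨n, hn, hlt'⟩ := (hb.and_eventually h1).exists
      rw [hv.pathWeight_succ hh (hs n), hn] at hlt'
      exact not_lt.2 (mul_le_mul_of_nonneg_left (hle _) (hv.pathWeight_pos hh s n).le) hlt'
    have : L = 0 := by nlinarith
    rwa [this] at hL
  · push Not at hrec
    -- Only finitely many arcs are deficient, and the path leaves each of them for good; afterwards
    -- every step divides by `lam`.
    have hev : ∀ᶠ n in atTop, coverRate f h v (s n) = lam := by
      have h1 : ∀ᶠ n in atTop, ∀ i ∈ {i | coverRate f h v i < lam}, s n ≠ i :=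
        (eventually_all_finite hv.finite).2 fun i _ => hrec i
      filter_upwards [h1] with n hn
      exact le_antisymm (hv.rate_le hh _) (not_lt.1 fun hlt => hn _ hlt rfl)
    obtain ⟨N, hN⟩ := eventually_atTop.1 hev
    have hlam : 0 < lam := zero_lt_one.trans hv.one_lt
    let C := ∏ k ∈ Finset.range N, coverRate f h v (s k)
    have hC : 0 < C := Finset.prod_pos fun _ _ => hv.rate_pos hh _
    have hprod : ∀ m, ∏ k ∈ Finset.range (N + m), coverRate f h v (s k) = C * lam ^ m := by
      intro m
      rw [Finset.prod_range_add]
      congr 1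
      rw [Finset.prod_congr rfl fun k _ => hN (N + k) (by omega), Finset.prod_const,
        Finset.card_range]
    rw [← tendsto_add_atTop_iff_nat N]
    have hgeo : Tendsto (fun m : ℕ => C⁻¹ * lam⁻¹ ^ m) atTop (𝓝 0) := by
      simpa using (tendsto_pow_atTop_nhds_zero_of_lt_one (inv_nonneg.2 hlam.le)
        (inv_lt_one_of_one_lt₀ hv.one_lt)).const_mul C⁻¹
    refine squeeze_zero (fun m => (hv.pathWeight_pos hh s _).le) (fun m => ?_) hgeo
    rw [pathWeight, add_comm m N, hprod, inv_pow, ← mul_inv, ← one_div]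
    exact div_le_div_of_nonneg_right (hv.le_one _) (by positivity)

end

/-! ### The path measure -/

section

open MeasureTheory

variable {G : Type u} {ι : Type u}

/-- Extend a finite word by repeating its last letter. -/
def extendWord {n : ℕ} (w : Fin (n + 1) → ι) (k : ℕ) : ι :=
  w ⟨min k n, Nat.lt_succ_of_le (min_le_right k n)⟩

theorem extendWord_apply {n : ℕ} (w : Fin (n + 1) → ι) {k : ℕ} (hk : k ≤ n) :
    extendWord w k = w ⟨k, Nat.lt_succ_of_le hk⟩ := by
  unfold extendWord
  congr 2
  exact min_eq_left hk

theorem extendWord_restrict (s : ℕ → ι) {n k : ℕ} (hk : k ≤ n) :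
    extendWord (fun i : Fin (n + 1) => s i) k = s k :=
  extendWord_apply _ hk

/-- The words of length `n + 1` whose cylinders are arcs contained in `γ`. -/
def wordsIn (f : G → G) (h : ι → unitInterval → G) (n : ℕ) (γ : Set G) : Set (Fin (n + 1) → ι) :=
  {w | (∀ k < n, Covers f h (extendWord w k) (extendWord w (k + 1))) ∧
    cyl f h (extendWord w) n ⊆ γ}

/-- The total weight of the cylinders of level `n` contained in `γ`. -/
noncomputable def wordSum (f : G → G) (h : ι → unitInterval → G) (v : ι → ℝ) (n : ℕ)
    (γ : Set G) : ℝ≥0∞ :=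
  ∑' w : wordsIn f h n γ, ENNReal.ofReal (pathWeight f h v (extendWord w.1) n)

/-- The limit of the total weights of the cylinders contained in `γ`. -/
noncomputable def wordSup (f : G → G) (h : ι → unitInterval → G) (v : ι → ℝ) (γ : Set G) : ℝ≥0∞ :=
  ⨆ n, wordSum f h v n γ

/-- The infinite paths. -/
def paths (f : G → G) (h : ι → unitInterval → G) : Set (ℕ → ι) :=
  {s | ∀ k, Covers f h (s k) (s (k + 1))}

/-- The infinite paths whose cylinder of level `n` lies in `γ`. -/
def pathEvent (f : G → G) (h : ι → unitInterval → G) (γ : Set G) (n : ℕ) : Set (ℕ → ι) :=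
  {s | s ∈ paths f h ∧ cyl f h s n ⊆ γ}

/-- A measure on paths giving to each finite path its weight. -/
structure IsPathMeasure (f : G → G) (h : ι → unitInterval → G) (v : ι → ℝ)
    [MeasurableSpace (ℕ → ι)] (μ : Measure (ℕ → ι)) : Prop where
  isProbabilityMeasure : IsProbabilityMeasure μ
  measurableSet : ∀ n i, MeasurableSet {ω : ℕ → ι | ω n = i}
  measure_word : ∀ n (s : ℕ → ι), (∀ k < n, Covers f h (s k) (s (k + 1))) →
    μ {ω | ∀ k ≤ n, ω k = s k} = ENNReal.ofReal (pathWeight f h v s n)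
  ae_mem_paths : ∀ᵐ ω ∂μ, ω ∈ paths f h

theorem pathEvent_monotone (f : G → G) (h : ι → unitInterval → G) (γ : Set G) :
    Monotone (pathEvent f h γ) :=
  fun _ _ hmn _ hs => ⟨hs.1, (cyl_antitone f h _ hmn).trans hs.2⟩

variable {f : G → G} {h : ι → unitInterval → G} {lam : ℝ} {v : ι → ℝ}

theorem IsSubeigen.exists_isPathMeasure [MetricSpace G] [CompactSpace G] [ConnectedSpace G]
    [Countable ι] (hv : IsSubeigen f h lam v) (hh : IsMarkovFamily f h) :
    ∃ (_ : MeasurableSpace (ℕ → ι)) (μ : Measure (ℕ → ι)), IsPathMeasure f h v μ := by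
  obtain ⟨m, μ, h1, h2, h3⟩ := exists_markovMeasure (fun i => ENNReal.ofReal (v i))
    (by rw [← ENNReal.ofReal_tsum_of_nonneg hv.nonneg hv.hasSum.summable, hv.hasSum.tsum_eq,
      ENNReal.ofReal_one])
    (fun i j => ENNReal.ofReal (coverProb f h v i j)) (fun i => by
      rw [← ENNReal.ofReal_tsum_of_nonneg (hv.coverProb_nonneg hh i)
        (hv.hasSum_coverProb hh i).summable, (hv.hasSum_coverProb hh i).tsum_eq,
        ENNReal.ofReal_one])
  have h4 : ∀ n (s : ℕ → ι), μ {ω | ∀ k ≤ n, ω k = s k} =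
      ENNReal.ofReal (v (s 0) * ∏ k ∈ Finset.range n, coverProb f h v (s k) (s (k + 1))) :=
    fun n s => by
      rw [h3, ENNReal.ofReal_mul (hv.nonneg _), ENNReal.ofReal_prod_of_nonneg]
      exact fun k _ => hv.coverProb_nonneg hh _ _
  refine ⟨m, μ, h1, h2, fun n s hs => by rw [h4, hv.prod_coverProb hh hs], ?_⟩
  change ∀ᵐ ω ∂μ, ∀ k, Covers f h (ω k) (ω (k + 1))
  rw [ae_all_iff]
  intro n
  have hsub : {ω : ℕ → ι | ¬ Covers f h (ω n) (ω (n + 1))} ⊆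
      ⋃ w : {w : Fin (n + 2) → ι // ¬ Covers f h (extendWord w n) (extendWord w (n + 1))},
        {ω | ∀ k ≤ n + 1, ω k = extendWord w.1 k} := by
    intro ω hω
    refine mem_iUnion.2 ⟨⟨fun i => ω i, ?_⟩, fun k hk => (extendWord_restrict ω hk).symm⟩
    rwa [extendWord_restrict ω (Nat.le_succ n), extendWord_restrict ω le_rfl]
  refine measure_mono_null hsub (measure_iUnion_null fun w => ?_)
  rw [h4, Finset.prod_range_succ, coverProb, coverMatrix_of_not_covers w.2]
  simp

variable [MeasurableSpace (ℕ → ι)] {μ : Measure (ℕ → ι)}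

theorem IsPathMeasure.measurableSet_word (hμ : IsPathMeasure f h v μ) (n : ℕ) (s : ℕ → ι) :
    MeasurableSet {ω : ℕ → ι | ∀ k ≤ n, ω k = s k} := by
  have : {ω : ℕ → ι | ∀ k ≤ n, ω k = s k} = ⋂ k ∈ Iic n, {ω | ω k = s k} := by
    ext ω; simp only [mem_ofPred_eq, mem_iInter, mem_Iic]
  rw [this]
  exact MeasurableSet.biInter (finite_Iic n).countable fun k _ => hμ.measurableSet k (s k)

/-- Almost every sequence is a path, and then the event depends only on the first `n + 1` letters.
This yields measurability and the link with sums over words. -/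
theorem IsPathMeasure.pathEvent_ae_eq (hμ : IsPathMeasure f h v μ) (n : ℕ) (γ : Set G) :
    pathEvent f h γ n =ᵐ[μ] ⋃ w : wordsIn f h n γ, {ω | ∀ k ≤ n, ω k = extendWord w.1 k} := by
  filter_upwards [hμ.ae_mem_paths] with ω hω
  refine propext ⟨fun h1 => mem_iUnion.2 ⟨⟨fun i => ω i, ?_, ?_⟩, fun k hk =>
    (extendWord_restrict ω hk).symm⟩, fun h1 => ⟨hω, ?_⟩⟩
  · intro k hk
    rw [extendWord_restrict ω hk.le, extendWord_restrict ω hk]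
    exact hω k
  · rw [cyl_congr f h fun k hk => extendWord_restrict ω hk]
    exact h1.2
  · obtain ⟨w, hw⟩ := mem_iUnion.1 h1
    rw [cyl_congr f h hw]
    exact w.2.2

theorem IsPathMeasure.wordSum_eq [Countable ι] (hμ : IsPathMeasure f h v μ) (n : ℕ) (γ : Set G) :
    wordSum f h v n γ = μ (pathEvent f h γ n) := by
  rw [measure_congr (hμ.pathEvent_ae_eq n γ), measure_iUnion _ fun w => hμ.measurableSet_word n _]
  · exact tsum_congr fun w => (hμ.measure_word n _ w.2.1).symm
  · intro w w' hne
    refine disjoint_left.2 fun ω h1 h2 => hne (Subtype.ext (funext fun k => ?_))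
    have h3 := (h1 k (Nat.le_of_lt_succ k.2)).symm.trans (h2 k (Nat.le_of_lt_succ k.2))
    rwa [extendWord_apply _ (Nat.le_of_lt_succ k.2),
      extendWord_apply _ (Nat.le_of_lt_succ k.2)] at h3

theorem IsPathMeasure.wordSup_eq [Countable ι] (hμ : IsPathMeasure f h v μ) (γ : Set G) :
    wordSup f h v γ = μ (⋃ n, pathEvent f h γ n) := by
  rw [(pathEvent_monotone f h γ).measure_iUnion]
  exact iSup_congr fun n => hμ.wordSum_eq n γ

theorem IsPathMeasure.nullMeasurableSet [Countable ι] (hμ : IsPathMeasure f h v μ) (γ : Set G) :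
    NullMeasurableSet (⋃ n, pathEvent f h γ n) μ :=
  .iUnion fun n => (MeasurableSet.iUnion fun _ => hμ.measurableSet_word n _).nullMeasurableSet.congr
    (hμ.pathEvent_ae_eq n γ).symm

variable [MetricSpace G] [CompactSpace G] [ConnectedSpace G] [Countable ι]

/-- The set is countable, and the mass of a single path is at most each of its weights, which tend
to 0. -/
theorem IsPathMeasure.measure_mem_cyl_eq_zero (hμ : IsPathMeasure f h v μ)
    (hv : IsSubeigen f h lam v) (hh : IsMarkovFamily f h) (x : G) :
    μ {s | s ∈ paths f h ∧ ∀ n, x ∈ cyl f h s n} = 0 := by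
  have := hv.nonempty
  have hc := hh.countable_itineraries x
  refine (measure_null_iff_singleton hc).2 fun s hs => ?_
  have hlim : Tendsto (fun n => ENNReal.ofReal (pathWeight f h v s n)) atTop (𝓝 0) := by
    simpa using (ENNReal.tendsto_ofReal (hv.tendsto_pathWeight hh hs.1))
  refine le_antisymm (ge_of_tendsto' hlim fun n => ?_) zero_le
  rw [← hμ.measure_word n s fun k _ => hs.1 k]
  exact measure_mono (singleton_subset_iff.2 fun k _ => rfl)

omit [MeasurableSpace (ℕ → ι)] [CompactSpace G] [ConnectedSpace G] [Countable ι] in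
theorem IsMarkovFamily.nontrivial_cyl (hh : IsMarkovFamily f h) {s : ℕ → ι}
    (hs : s ∈ paths f h) (n : ℕ) : (cyl f h s n).Nontrivial := by
  obtain ⟨g, -, gi, gr, -⟩ := hh.exists_cyl_param (n := n) fun k _ => hs k
  exact ⟨g 0, gr ▸ mem_range_self 0, g 1, gr ▸ mem_range_self 1, fun e => zero_ne_one (gi e)⟩

theorem IsPathMeasure.wordSup_union (hμ : IsPathMeasure f h v μ)
    (hv : IsSubeigen f h lam v) (hh : IsMarkovFamily f h) {γ₁ γ₂ : Set G} {t : G}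
    (h₁ : IsClosed γ₁) (h₂ : IsClosed γ₂) (ht : γ₁ ∩ γ₂ = {t}) :
    wordSup f h v (γ₁ ∪ γ₂) = wordSup f h v γ₁ + wordSup f h v γ₂ := by
  rw [hμ.wordSup_eq, hμ.wordSup_eq, hμ.wordSup_eq, ← measure_union₀ (hμ.nullMeasurableSet γ₂)]
  · refine measure_congr ?_
    have hnull := hμ.measure_mem_cyl_eq_zero hv hh t
    filter_upwards [measure_eq_zero_iff_ae_notMem.1 hnull, hμ.ae_mem_paths] with s hs hsp
    refine propext ⟨fun hsu => ?_, ?_⟩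
    · obtain ⟨n, hn⟩ := mem_iUnion.1 hsu
      have : ∃ m, t ∉ cyl f h s m := by
        by_contra! hm
        exact hs ⟨hsp, hm⟩
      obtain ⟨m, hm⟩ := this
      have hN : cyl f h s (max n m) ⊆ γ₁ ∪ γ₂ := (cyl_antitone f h s (le_max_left n m)).trans hn.2
      have htN : t ∉ cyl f h s (max n m) := fun h' => hm (cyl_antitone f h s (le_max_right n m) h')
      obtain ⟨g, gc, -, gr, -⟩ := hh.exists_cyl_param (n := max n m) fun k _ => hsp k
      have hpre : IsPreconnected (cyl f h s (max n m)) := gr ▸ isPreconnected_range gc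
      -- The cylinder is connected and misses `t`, so it lies in one of the two closed pieces.
      by_cases hcase : cyl f h s (max n m) ⊆ γ₂
      · exact Or.inr (mem_iUnion.2 ⟨_, hsp, hcase⟩)
      · obtain ⟨p, hp, hp2⟩ := not_subset.1 hcase
        refine Or.inl (mem_iUnion.2 ⟨_, hsp, subset_of_isPreconnected_of_isClosed hpre h₁ h₂ hN
          (fun z hz hz1 hz2 => htN ?_) hp ((hN hp).resolve_right hp2)⟩)
        obtain rfl : z = t := by
          have : z ∈ γ₁ ∩ γ₂ := ⟨hz1, hz2⟩
          rwa [ht] at this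
        exact hz
    · rintro (hs1 | hs1)
      · obtain ⟨n, hn⟩ := mem_iUnion.1 hs1
        exact mem_iUnion.2 ⟨n, hsp, hn.2.trans subset_union_left⟩
      · obtain ⟨n, hn⟩ := mem_iUnion.1 hs1
        exact mem_iUnion.2 ⟨n, hsp, hn.2.trans subset_union_right⟩
  -- A path in both events would have a cylinder inside `{t}`, but cylinders are nondegenerate.
  · refine (disjoint_left.2 fun s hs1 hs2 => ?_).aedisjoint
    obtain ⟨n, hn⟩ := mem_iUnion.1 hs1
    obtain ⟨m, hm⟩ := mem_iUnion.1 hs2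
    obtain ⟨p, hp, q, hq, hpq⟩ := hh.nontrivial_cyl hn.1 (max n m)
    have key : cyl f h s (max n m) ⊆ {t} := ht ▸ subset_inter
      ((cyl_antitone f h s (le_max_left n m)).trans hn.2)
      ((cyl_antitone f h s (le_max_right n m)).trans hm.2)
    exact hpq ((key hp).trans (key hq).symm)

theorem IsPathMeasure.tendsto_wordSup (hμ : IsPathMeasure f h v μ)
    (hv : IsSubeigen f h lam v) (hh : IsMarkovFamily f h) {γ : ℕ → Set G} {x : G}
    (hanti : Antitone γ) (hx : ⋂ m, γ m = {x}) :
    Tendsto (fun m => wordSup f h v (γ m)) atTop (𝓝 0) := by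
  have := hμ.isProbabilityMeasure
  simp only [hμ.wordSup_eq]
  have hlim := tendsto_measure_iInter_atTop (μ := μ) (fun m => hμ.nullMeasurableSet (γ m))
    (fun a b hab s hs => by
      obtain ⟨n, hn⟩ := mem_iUnion.1 hs
      exact mem_iUnion.2 ⟨n, hn.1, hn.2.trans (hanti hab)⟩) ⟨0, measure_ne_top μ _⟩
  have hzero : μ (⋂ m, ⋃ n, pathEvent f h (γ m) n) = 0 := by
    -- The nested compact cylinders of such a path have a common point. It lies in every `γ m`, so
    -- it is `x`.
    refine measure_mono_null (fun s hs => ?_) (hμ.measure_mem_cyl_eq_zero hv hh x)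
    have hs' : ∀ m, ∃ n, s ∈ pathEvent f h (γ m) n := fun m => mem_iUnion.1 (mem_iInter.1 hs m)
    have hsp : s ∈ paths f h := (hs' 0).choose_spec.1
    have hcomp : ∀ n, IsCompact (cyl f h s n) := fun n => by
      obtain ⟨g, gc, -, gr, -⟩ := hh.exists_cyl_param (n := n) fun k _ => hsp k
      exact gr ▸ isCompact_range gc
    obtain ⟨z, hz⟩ := IsCompact.nonempty_iInter_of_directed_nonempty_isCompact_isClosed
      (cyl f h s) (cyl_antitone f h s).directed_ge
      (fun n => (hh.nontrivial_cyl hsp n).nonempty) hcomp fun n => (hcomp n).isClosed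
    rw [mem_iInter] at hz
    obtain rfl : z = x := by
      have : z ∈ ⋂ m, γ m := mem_iInter.2 fun m => by
        obtain ⟨n, hn⟩ := hs' m
        exact hn.2 (hz n)
      rwa [hx] at this
    exact ⟨hsp, hz⟩
  rwa [hzero] at hlim

end

/-! ### Positivity and minimizing arcs -/

section

open MeasureTheory

variable {G : Type u} {ι : Type u} [MetricSpace G] [CompactSpace G] [ConnectedSpace G]
  [Countable ι] {f : G → G} {h : ι → unitInterval → G} {lam : ℝ} {v : ι → ℝ}

theorem IsSubeigen.wordSup_pos (hv : IsSubeigen f h lam v) (hh : IsMarkovFamily f h) {γ : Set G}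
    (hγ : IsArc γ) : 0 < wordSup f h v γ := by
  have := hv.nonempty
  obtain ⟨_, _, g, gc, gi, rfl, -, -⟩ := hγ
  obtain ⟨t, ht, htQ⟩ : ∃ t ∈ Ioo (0 : unitInterval) 1, g t ∉ exceptional h := by
    by_contra! hn
    exact not_countable_Ioo_unitInterval zero_lt_one
      ((hh.countable_exceptional.preimage gi).mono hn)
  obtain ⟨i, hi⟩ := notMem_exceptional.1 htQ
  have hint := mem_interior_range (hh.continuous i) (hh.injective i) (hh.isOpen i) gc gi ht hi
  obtain ⟨s, n, hs, hsub⟩ := hh.exists_cyl_subset isOpen_interior ⟨_, hint⟩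
  have hw : (fun k : Fin (n + 1) => s k) ∈ wordsIn f h n (range g) := by
    refine ⟨fun k hk => ?_, ?_⟩
    · rw [extendWord_restrict s hk.le, extendWord_restrict s hk]
      exact hs k hk
    · rw [cyl_congr f h fun k hk => extendWord_restrict s hk]
      exact hsub.trans interior_subset
  have h1 : 0 < ENNReal.ofReal (pathWeight f h v (extendWord fun k : Fin (n + 1) => s k) n) :=
    ENNReal.ofReal_pos.2 (hv.pathWeight_pos hh _ _)
  exact h1.trans_le ((ENNReal.le_tsum (f := fun w : wordsIn f h n (range g) =>
    ENNReal.ofReal (pathWeight f h v (extendWord w.1) n)) ⟨_, hw⟩).trans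
      (le_iSup (fun n => wordSum f h v n (range g)) n))

omit [Countable ι] in
/-- An arc meeting the interior of a cylinder that contains none of its endpoints contains the
cylinder. -/
theorem IsMarkovFamily.cyl_subset_of_inter_nonempty [Nonempty ι] (hh : IsMarkovFamily f h)
    {s : ℕ → ι} (hs : s ∈ paths f h) {n : ℕ} {x y : G} {γ : Set G} (hγ : IsArcBetween x y γ)
    (hx : x ∉ cyl f h s n) (hy : y ∉ cyl f h s n) (hne : (γ ∩ cylInt f h s n).Nonempty) :
    cyl f h s n ⊆ γ := by
  obtain ⟨k, kc, ki, rfl, rfl, rfl⟩ := hγ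
  obtain ⟨g, gc, gi, gr, gf⟩ := hh.exists_cyl_param (n := n) fun k _ => hs k
  have hI := hh.image_Ioo_eq_cylInt gr gf
  have hsub := image_Ioo_subset_of_inter_nonempty gc gi (hI ▸ hh.isOpen_cylInt s n) kc ki
    (fun h' => hx (gr ▸ image_subset_range _ _ h')) (fun h' => hy (gr ▸ image_subset_range _ _ h'))
    (hI ▸ hne)
  rw [← gr, ← closure_image_Ioo gc]
  exact closure_minimal hsub (isCompact_range kc).isClosed

omit [MetricSpace G] [CompactSpace G] [ConnectedSpace G] in
/-- Along a subsequence, every cylinder is eventually contained or eventually not contained in the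
terms of a sequence of sets. -/
theorem exists_subseq_cyl_stable (f : G → G) (h : ι → unitInterval → G) (β : ℕ → Set G) :
    ∃ θ : ℕ → ℕ, StrictMono θ ∧ ∀ (s : ℕ → ι) (n : ℕ),
      (∃ᶠ k in atTop, cyl f h s n ⊆ β (θ k)) → ∀ᶠ k in atTop, cyl f h s n ⊆ β (θ k) := by
  classical
  -- Diagonal argument: there are countably many words, so the space of 0-1 functions on them is
  -- sequentially compact.
  obtain ⟨b, -, θ, θm, hθ⟩ := isCompact_univ.tendsto_subseq (x := fun k =>
    fun σ : (Σ n, (Fin (n + 1) → ι)) => decide (cyl f h (extendWord σ.2) σ.1 ⊆ β k))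
    fun _ => mem_univ _
  refine ⟨θ, θm, fun s n hfr => ?_⟩
  have h1 := (tendsto_pi_nhds.1 hθ) ⟨n, fun i => s i⟩
  rw [nhds_discrete, tendsto_pure] at h1
  have h2 : cyl f h (extendWord fun i : Fin (n + 1) => s i) n = cyl f h s n :=
    cyl_congr f h fun k hk => extendWord_restrict s hk
  simp only [Function.comp_apply, h2] at h1
  obtain ⟨k, hk, hk'⟩ := (hfr.and_eventually h1).exists
  filter_upwards [h1] with k' hk''
  rw [← hk'] at hk''
  simpa [hk] using hk''

omit [ConnectedSpace G] in
/-- The upper limit of a sequence of arcs joining two points is a continuum containing them. -/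
theorem isPreconnected_iInter_closure_iUnion {β : ℕ → Set G} {x y : G}
    (hβ : ∀ k, IsArcBetween x y (β k)) :
    IsPreconnected (⋂ N, closure (⋃ k : {k // N ≤ k}, β k.1)) ∧
      x ∈ ⋂ N, closure (⋃ k : {k // N ≤ k}, β k.1) ∧ y ∈ ⋂ N, closure (⋃ k : {k // N ≤ k}, β k.1) := by
  have hxβ : ∀ k, x ∈ β k ∧ y ∈ β k := fun k => by
    obtain ⟨g, -, -, hr, h0, h1⟩ := hβ k
    exact ⟨hr ▸ h0 ▸ mem_range_self 0, hr ▸ h1 ▸ mem_range_self 1⟩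
  have hβpre : ∀ k, IsPreconnected (β k) := fun k => by
    obtain ⟨g, gc, -, hr, -⟩ := hβ k
    exact hr ▸ isPreconnected_range gc
  have hanti : Antitone fun N => closure (⋃ k : {k // N ≤ k}, β k.1) := fun N N' hN =>
    closure_mono (iUnion_subset fun k =>
      subset_iUnion (fun k : {k // N ≤ k} => β k.1) ⟨k.1, hN.trans k.2⟩)
  have hmem : ∀ z, (∀ k, z ∈ β k) → z ∈ ⋂ N, closure (⋃ k : {k // N ≤ k}, β k.1) := fun z hz =>
    mem_iInter.2 fun N => subset_closure (mem_iUnion.2 ⟨⟨N, le_rfl⟩, hz _⟩)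
  exact ⟨isPreconnected_iInter_of_directed hanti.directed_ge (fun N => isClosed_closure.isCompact)
    fun N => (isPreconnected_iUnion ⟨x, mem_iInter.2 fun k => (hxβ _).1⟩ fun k => hβpre _).closure,
    hmem x fun k => (hxβ k).1, hmem y fun k => (hxβ k).2⟩

theorem IsSubeigen.exists_isLeast_wordSup (hv : IsSubeigen f h lam v) (hh : IsMarkovFamily f h)
    {x y : G} (hxy : x ≠ y) :
    ∃ α, IsArcBetween x y α ∧ ∀ β, IsArcBetween x y β → wordSup f h v α ≤ wordSup f h v β := by
  have := hv.nonempty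
  obtain ⟨m, μ, hμ⟩ := hv.exists_isPathMeasure hh
  obtain ⟨γ₀, -, hγ₀⟩ := hh.exists_isArcBetween isCompact_univ isPreconnected_univ
    (mem_univ x) (mem_univ y) hxy
  obtain ⟨u, -, hu, huS⟩ := exists_seq_tendsto_sInf
    (S := wordSup f h v '' {γ | IsArcBetween x y γ}) ⟨_, γ₀, hγ₀, rfl⟩ (OrderBot.bddBelow _)
  choose β hβ hβu using huS
  replace hβ : ∀ k, IsArcBetween x y (β k) := hβ
  obtain rfl : (fun k => wordSup f h v (β k)) = u := funext hβu
  obtain ⟨θ, θm, hstab⟩ := exists_subseq_cyl_stable f h β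
  obtain ⟨hTpre, hxT, hyT⟩ := isPreconnected_iInter_closure_iUnion fun k => hβ (θ k)
  obtain ⟨α, hαT, hα⟩ := hh.exists_isArcBetween
    (isClosed_iInter fun N => isClosed_closure).isCompact hTpre hxT hyT hxy
  refine ⟨α, hα, fun β' hβ' => ?_⟩
  have hinf : sInf (wordSup f h v '' {γ | IsArcBetween x y γ}) ≤ wordSup f h v β' :=
    sInf_le ⟨β', hβ', rfl⟩
  refine le_trans ?_ hinf
  -- The paths counted by every `β (θ k)` with `k ≥ N`; the union of these sets over `N` is the
  -- lower limit of the events.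
  let D : ℕ → Set (ℕ → ι) := fun N => ⋂ k ≥ N, ⋃ n, pathEvent f h (β (θ k)) n
  have hDmono : Monotone D := fun N N' hN => biInter_subset_biInter_left fun k hk => hN.trans hk
  have hsub : μ (⋃ n, pathEvent f h α n) ≤ μ (⋃ N, D N) := by
    refine measure_mono_ae ?_
    filter_upwards [measure_eq_zero_iff_ae_notMem.1 (hμ.measure_mem_cyl_eq_zero hv hh x),
      measure_eq_zero_iff_ae_notMem.1 (hμ.measure_mem_cyl_eq_zero hv hh y)] with s hsx hsy hs
    obtain ⟨n, hsp, hn⟩ := mem_iUnion.1 hs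
    obtain ⟨n₁, hn₁⟩ : ∃ m, x ∉ cyl f h s m := by
      by_contra! hm
      exact hsx ⟨hsp, hm⟩
    obtain ⟨n₂, hn₂⟩ : ∃ m, y ∉ cyl f h s m := by
      by_contra! hm
      exact hsy ⟨hsp, hm⟩
    let n' := max n (max n₁ n₂)
    have hx' : x ∉ cyl f h s n' := fun h' => hn₁ (cyl_antitone f h s
      ((le_max_left _ _).trans (le_max_right _ _)) h')
    have hy' : y ∉ cyl f h s n' := fun h' => hn₂ (cyl_antitone f h s
      ((le_max_right _ _).trans (le_max_right _ _)) h')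
    have hα' : cyl f h s n' ⊆ α := (cyl_antitone f h s (le_max_left _ _)).trans hn
    obtain ⟨g, -, -, gr, gf⟩ := hh.exists_cyl_param (n := n') fun k _ => hsp k
    obtain ⟨c, hc⟩ : (cylInt f h s n').Nonempty :=
      hh.image_Ioo_eq_cylInt gr gf ▸ image_Ioo_nonempty
    have hcT := hαT (hα' (cylInt_subset_cyl hc))
    -- Since `c` is in the upper limit and inside the open cylinder, infinitely many of the arcs
    -- meet that open set. Their end points are outside the cylinder, so each of them contains it.
    have hfr : ∃ᶠ k in atTop, cyl f h s n' ⊆ β (θ k) := by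
      rw [frequently_atTop]
      intro N
      obtain ⟨z, hz, hzβ⟩ := mem_closure_iff.1 (mem_iInter.1 hcT N) _ (hh.isOpen_cylInt s n') hc
      obtain ⟨k, hk⟩ := mem_iUnion.1 hzβ
      exact ⟨k, k.2, hh.cyl_subset_of_inter_nonempty hsp (hβ _) hx' hy' ⟨z, hk, hz⟩⟩
    obtain ⟨N, hN⟩ := eventually_atTop.1 (hstab s n' hfr)
    exact mem_iUnion.2 ⟨N, mem_iInter₂.2 fun k hk => mem_iUnion.2 ⟨n', hsp, hN k hk⟩⟩
  rw [hμ.wordSup_eq]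
  refine hsub.trans ?_
  rw [hDmono.measure_iUnion]
  -- `D N` lies in the event of every later `β (θ k)`, so its measure is at most the limit of the
  -- minimizing values.
  refine iSup_le fun N => ge_of_tendsto (hu.comp θm.tendsto_atTop) ?_
  filter_upwards [eventually_ge_atTop N] with k hk
  rw [Function.comp_apply, hμ.wordSup_eq]
  exact measure_mono (biInter_subset_of_mem hk)

end

/-! ### Translation to the partition -/

section

variable {G : Type u} [MetricSpace G] [CompactSpace G] [ConnectedSpace G] {f : G → G}
  {P : Set (Set G)} {h : P → unitInterval → G}

omit [CompactSpace G] [ConnectedSpace G] in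
theorem IsMarkovPartition.exists_isMarkovFamily (hP : IsMarkovPartition f P) (hf : Continuous f)
    (hmix : IsTopMixing f) :
    ∃ h : P → unitInterval → G, IsMarkovFamily f h ∧ (∀ i, range (h i) = i) ∧
      ∀ i : P, arcInterior (i : Set G) = h i '' Ioo 0 1 := by
  choose h hc hi hr hint ho using fun i : P => (hP.tame.freeArc i i.2).exists_param
  have := hP.tame.countable.to_subtype
  refine ⟨h, ⟨⟨hc, hi, ho, fun i j hij => ?_, ?_⟩, hf, fun i => ?_, fun i j hij => ?_, hmix⟩, hr,
    hint⟩
  · rw [← hint, ← hint]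
    exact hP.tame.disjoint i i.2 j j.2 fun e => hij (Subtype.ext e)
  -- The partition covers by closed arcs; passing to open arcs loses only the countably many end
  -- points.
  · refine (hP.tame.cover.union (countable_iUnion fun i : P =>
      (toFinite {h i 0, h i 1}).countable)).mono fun z hz => ?_
    by_contra hn
    simp only [mem_union, mem_compl_iff, not_or, not_not, mem_iUnion] at hn hz
    obtain ⟨⟨i, hiP, hzi⟩, hz2⟩ := hn
    refine hz ⟨⟨i, hiP⟩, ?_⟩
    rw [image_Ioo_eq_range_diff (hi _)]
    exact ⟨by rwa [hr], fun h' => hz2 ⟨_, h'⟩⟩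
  · rw [hr]
    exact injOn_iff_injective.2 (hP.monotone i i.2).injective
  · rw [hr, hr]
    rw [hr, ← hint] at hij
    exact hP.markov i i.2 j j.2 hij

omit [MetricSpace G] [CompactSpace G] [ConnectedSpace G] in
theorem cylinder_eq_cyl (hr : ∀ i, range (h i) = i) {n : ℕ} (w : Fin (n + 1) → P) :
    cylinder f w = cyl f h (extendWord w) n := by
  ext p
  simp only [cylinder, cyl, mem_iInter, mem_preimage, mem_ofPred_eq]
  constructor
  · intro hp k hk
    rw [extendWord_apply w hk, hr]
    exact hp ⟨k, Nat.lt_succ_of_le hk⟩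
  · intro hp k
    have := hp k (Nat.le_of_lt_succ k.2)
    rwa [extendWord_apply w (Nat.le_of_lt_succ k.2), hr] at this

omit [MetricSpace G] [CompactSpace G] [ConnectedSpace G] in
theorem transition_eq_coverMatrix (hr : ∀ i, range (h i) = i) (i j : P) :
    transition f P i j = coverMatrix f h i j := by
  by_cases hc : Covers f h i j
  · rw [coverMatrix_of_covers hc]
    exact if_pos (by rwa [Covers, hr, hr] at hc)
  · rw [coverMatrix_of_not_covers hc]
    exact if_neg (by rwa [Covers, hr, hr] at hc)

omit [MetricSpace G] [CompactSpace G] [ConnectedSpace G] in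
theorem rate_eq_coverRate (hr : ∀ i, range (h i) = i) (v : P → ℝ) (i : P) :
    rate f P v i = coverRate f h v i := by
  simp only [rate, coverRate, transition_eq_coverMatrix hr]

omit [MetricSpace G] [CompactSpace G] [ConnectedSpace G] in
theorem weight_eq_pathWeight (hr : ∀ i, range (h i) = i) (v : P → ℝ) {n : ℕ}
    (w : Fin (n + 1) → P) : weight f P v w = pathWeight f h v (extendWord w) n := by
  rw [weight, pathWeight, Finset.prod_range, extendWord_apply w le_rfl]
  congr 1
  refine Finset.prod_congr rfl fun k _ => ?_
  rw [rate_eq_coverRate hr, extendWord_apply w k.2.le]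
  rfl

omit [CompactSpace G] [ConnectedSpace G] in
theorem partitionPoints_eq_exceptional
    (hint : ∀ i : P, arcInterior (i : Set G) = h i '' Ioo 0 1) :
    partitionPoints P = exceptional h := by
  rw [partitionPoints, exceptional, biUnion_eq_iUnion]
  simp only [hint]

/-- The elements of the refined partitions are the cylinders of the finite paths. -/
theorem IsMarkovFamily.cyl_mem_refinement_iff [Nonempty P] (hh : IsMarkovFamily f h)
    (hint : ∀ i : P, arcInterior (i : Set G) = h i '' Ioo 0 1) {s : ℕ → P} {n : ℕ} :
    cyl f h s n ∈ refinement f P n ↔ ∀ k < n, Covers f h (s k) (s (k + 1)) := by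
  simp only [refinement, partitionPoints_eq_exceptional hint, mem_ofPred_eq]
  constructor
  · rintro ⟨x, hx, e⟩ k hk
    have hxs : x ∈ cyl f h s n := e ▸ subset_closure (mem_connectedComponentIn hx)
    exact hh.covers_of_mem_cylInt (hh.mem_cylInt hxs hx) hk
  · intro hs
    obtain ⟨g, gc, gi, gr, gf⟩ := hh.exists_cyl_param hs
    have hI := hh.image_Ioo_eq_cylInt gr gf
    obtain ⟨x, hx⟩ : (cylInt f h s n).Nonempty := hI ▸ image_Ioo_nonempty
    have hxO : x ∈ (f^[n] ⁻¹' exceptional h)ᶜ := notMem_exceptional_of_mem_cylInt hx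
    refine ⟨x, hxO, ?_⟩
    rw [← gr, ← closure_image_Ioo gc, hI]
    congr 1
    apply Subset.antisymm
    · exact (hI ▸ isPreconnected_image_Ioo gc).subset_connectedComponentIn hx
        fun z hz => notMem_exceptional_of_mem_cylInt hz
    -- The open cylinder and the complement of the closed one are disjoint open sets covering
    -- everything off the preimage of the exceptional set, so the component cannot leave the open
    -- cylinder.
    · have hcl : IsClosed (cyl f h s n) := gr ▸ (isCompact_range gc).isClosed
      refine isPreconnected_connectedComponentIn.subset_left_of_subset_union
        (hh.isOpen_cylInt s n) hcl.isOpen_compl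
        (disjoint_compl_right.mono_left cylInt_subset_cyl) (fun z hz => ?_)
        ⟨x, mem_connectedComponentIn hxO, hx⟩
      have hzO := connectedComponentIn_subset _ _ hz
      by_cases hzc : z ∈ cyl f h s n
      · exact Or.inl (hh.mem_cylInt hzc hzO)
      · exact Or.inr hzc

theorem IsMarkovFamily.arcMapN_eq_wordSum [Nonempty P] (hh : IsMarkovFamily f h)
    (hr : ∀ i, range (h i) = i) (hint : ∀ i : P, arcInterior (i : Set G) = h i '' Ioo 0 1)
    (v : P → ℝ) (n : ℕ) (γ : Set G) : arcMapN f P v n γ = wordSum f h v n γ := by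
  have hiff : ∀ w : Fin (n + 1) → P, (cylinder f w ∈ refinement f P n ∧ cylinder f w ⊆ γ) ↔
      w ∈ wordsIn f h n γ := fun w => by
    rw [cylinder_eq_cyl hr, hh.cyl_mem_refinement_iff hint]
    rfl
  rw [arcMapN, wordSum, ← (Equiv.subtypeEquivRight hiff).tsum_eq]
  exact tsum_congr fun w => by rw [weight_eq_pathWeight hr]; rfl

end

theorem isCompact_of_mem_pointsAndArcs {G : Type u} [TopologicalSpace G] {γ : Set G}
    (hγ : γ ∈ pointsAndArcs G) : IsCompact γ := by
  rcases hγ with ⟨x, rfl⟩ | ⟨x, y, g, gc, -, rfl, -⟩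
  · exact isCompact_singleton
  · exact isCompact_range gc

end TameGraph

theorem mainTheorem10 {G : Type*} [MetricSpace G] [CompactSpace G] [ConnectedSpace G]
    (hG : TameGraph.IsTameGraph G)
    (f : G → G) (hf : TameGraph.IsCPM f)
    (P : Set (Set G)) (hP : TameGraph.IsMarkovPartition f P)
    (lam : ℝ) (hlam : 1 < lam)
    (v : P → ℝ) (hv : TameGraph.IsSubeigenvector f P lam v) (hsum : HasSum v 1)
    (hdef : {i : P | TameGraph.rate f P v i < lam}.Finite) :
    -- the arc maps take finite values
    (∀ γ ∈ TameGraph.pointsAndArcs G, TameGraph.arcMap f P v γ < ⊤) ∧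
    -- (i) monotone limit
    (∀ γ ∈ TameGraph.pointsAndArcs G,
      (∀ n : ℕ, TameGraph.arcMapN f P v n γ ≤ TameGraph.arcMapN f P v (n + 1) γ) ∧
      Tendsto (fun n : ℕ => TameGraph.arcMapN f P v n γ) atTop
        (𝓝 (TameGraph.arcMap f P v γ))) ∧
    -- (ii) positivity
    (∀ γ ∈ TameGraph.pointsAndArcs G, (¬ ∃ x, γ = {x}) → 0 < TameGraph.arcMap f P v γ) ∧
    -- (iii) additivity
    (∀ γ ∈ TameGraph.pointsAndArcs G, ∀ t ∈ γ,
      ∀ γ₁ ∈ TameGraph.pointsAndArcs G, ∀ γ₂ ∈ TameGraph.pointsAndArcs G,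
        γ = γ₁ ∪ γ₂ → γ₁ ∩ γ₂ = {t} →
        TameGraph.arcMap f P v γ = TameGraph.arcMap f P v γ₁ + TameGraph.arcMap f P v γ₂) ∧
    -- (iv) continuity along nested sequences shrinking to a point
    (∀ (γ : ℕ → Set G) (x : G), (∀ m, γ m ∈ TameGraph.pointsAndArcs G) →
      (∀ m, γ (m + 1) ⊆ γ m) → (⋂ m, γ m) = {x} →
      Tendsto (fun m : ℕ => TameGraph.arcMap f P v (γ m)) atTop (𝓝 0)) ∧
    -- (v) the infimum over the arcs joining two points is attained
    (∀ x y : G, x ≠ y → ∃ α ∈ TameGraph.arcsBetween x y,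
      TameGraph.arcMap f P v α =
        ⨅ β ∈ TameGraph.arcsBetween x y, TameGraph.arcMap f P v β) := by
  obtain ⟨h, hh, hr, hint⟩ := hP.exists_isMarkovFamily hf.continuous hf.mixing
  have := hP.tame.countable.to_subtype
  have hv' : TameGraph.IsSubeigen f h lam v := by
    refine ⟨hlam, hv.nonneg, hsum, ?_, ?_, ?_⟩
    · simpa only [TameGraph.transition_eq_coverMatrix hr] using hv.summable
    · simpa only [TameGraph.transition_eq_coverMatrix hr] using hv.le
    · simpa only [TameGraph.rate_eq_coverRate hr] using hdef
  have := hv'.nonempty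
  have hN : ∀ n γ, TameGraph.arcMapN f P v n γ = TameGraph.wordSum f h v n γ := fun n γ =>
    hh.arcMapN_eq_wordSum hr hint v n γ
  have hA : ∀ γ, TameGraph.arcMap f P v γ = TameGraph.wordSup f h v γ := fun γ =>
    iSup_congr fun n => hN n γ
  obtain ⟨_, μ, hμ⟩ := hv'.exists_isPathMeasure hh
  have := hμ.isProbabilityMeasure
  have hmono : ∀ γ, Monotone fun n => TameGraph.wordSum f h v n γ := fun γ a b hab => by
    simp only [hμ.wordSum_eq]
    exact MeasureTheory.measure_mono (TameGraph.pathEvent_monotone f h γ hab)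
  simp only [hA, hN]
  refine ⟨fun γ _ => ?_, fun γ _ => ⟨fun n => hmono γ n.le_succ, tendsto_atTop_iSup (hmono γ)⟩,
    fun γ hγ hpt => hv'.wordSup_pos hh (hγ.resolve_left hpt), ?_, ?_, ?_⟩
  · rw [hμ.wordSup_eq]
    exact MeasureTheory.measure_lt_top μ _
  · rintro γ - t - γ₁ h₁ γ₂ h₂ rfl ht
    exact hμ.wordSup_union hv' hh (TameGraph.isCompact_of_mem_pointsAndArcs h₁).isClosed
      (TameGraph.isCompact_of_mem_pointsAndArcs h₂).isClosed ht
  · intro γ x _ hanti hx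
    exact hμ.tendsto_wordSup hv' hh (antitone_nat_of_succ_le hanti) hx
  · intro x y hxy
    obtain ⟨α, hα, hmin⟩ := hv'.exists_isLeast_wordSup hh hxy
    exact ⟨α, hα, le_antisymm (le_iInf₂ hmin) (iInf₂_le α hα)⟩
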